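/- **Theorem.** Let $n\ge 1$, write points of $\mathbb{R}^{n+1}$ as $x=(x_0,\vec x)$ with $\vec x\in\mathbb{R}^n$, and let $f:\mathbb{R}^{n+1}\to\mathbb{R}$ be a smooth function for which $0$ is a regular value. Suppose that the hypersurface $M=f^{-1}(0)$ is compact and connected, and that $N=M\cap\{x_0=0\}$ is non-empty. Assume: * (A1) there is $\delta>0$ such that $f(x_0,\vec x)=f(-x_0,\vec x)$ for every $(x_0,\vec x)\in M$ with $|x_0|<\delta$; * (A2) $\mathrm{Hess}(f)_x(y,y)>0$ for every $x\in M$ and every $y\in T_xM$ with $y\neq 0$. For a submanifold $S\subset\mathbb{R}^{n+1}$ with the induced metric, identify $T^*S$ with $\{(x,y): x\in S,\ y\in T_xS\}\subset T^*\mathbb{R}^{n+1}=\mathbb{R}^{n+1}\times\mathbb{R}^{n+1}$ and put $ST^*S=\{(x,y)\in T^*S:\|y\|=1\}$. Let $Y=ST^*M$ and $B=ST^*N$, and define $$\pi:Y\setminus B\to S^1\subset\mathbb{C},\qquad \pi(x,y)=\frac{x_0+iy_0}{|x_0+iy_0|}.$$ Let $X_H$ be the geodesic vector field on $T^*M$,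 i.e. the Hamiltonian vector field ($\omega(X_H,\cdot)=dH$) of $H(x,y)=\tfrac12(\|y\|^2-1)$ restricted to $T^*M$, with respect to the symplectic form $\omega=\sum_j dx_j\wedge dy_j$ restricted to $T^*M$. Then: 1. $(B,\pi)$ is an open book decomposition of $Y$. That is: $Y$ is a closed manifold (an embedded submanifold of $\mathbb{R}^{n+1}\times\mathbb{R}^{n+1}$); $B\subset Y$ is a closed submanifold of codimension $2$; there is a diffeomorphism $\xi$ from $B\times D^2$ ($D^2\subset\mathbb{C}$ the open unit disk) onto an open neighborhood of $B$ in $Y$ with $\xi(b,0)=b$ and $\pi(\xi(b,re^{i\theta}))=e^{i\theta}$ for $b\in B$, $0<r<1$; and $\pi:Y\setminus B\to S^1$ is a smooth fiber bundle with non-empty fiber. 2. The vector field $X_H$ exists (it is then unique), and it is adapted to $(B,\pi)$: it restricts to a smooth vector field on $Y$, it is transverse to the interior $\pi^{-1}(e^{i\theta})$ of every page, i.e. $T_p\pi^{-1}(\pi(p))+\mathbb{R}X_H(p)=T_pY$ for all $p\in Y\setminus B$, and it is tangent to $B$. 3. The angular form $\Theta=i\,d\log\pi=\dfrac{y_0\,dx_0-x_0\,dy_0}{x_0^2+y_0^2}$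 has a uniform positive lower bound along $X_H$: there is $\varepsilon>0$ such that $\Theta_p(X_H(p))>\varepsilon$ for all $p\in Y\setminus B$. -/

import Mathlib

open scoped ContDiff

noncomputable section

/-! ### Submanifolds of a real normed space

For a submanifold `S` of `V`, `ContDiffOn ℝ ∞ φ S` is smoothness of `φ` as a map on the manifold `S`:
restrictions to `S` of locally defined ambient smooth maps are smooth in this sense, and conversely
the composition of such a `φ` with a smooth local parametrization of `S` is smooth. -/

section Submanifolds

variable {V W : Type*} [NormedAddCommGroup V] [NormedSpace ℝ V]
  [NormedAddCommGroup W] [NormedSpace ℝ W]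

/-- `S` is an embedded smooth submanifold (without boundary) of `W` of codimension `c`: near each of
its points it is cut out by `c` independent smooth equations. -/
def IsEmbeddedSubmanifold (c : ℕ) (S : Set W) : Prop :=
  ∀ p ∈ S, ∃ U : Set W, IsOpen U ∧ p ∈ U ∧ ∃ g : W → EuclideanSpace ℝ (Fin c),
    ContDiffOn ℝ ∞ g U ∧ S ∩ U = {x ∈ U | g x = 0} ∧
      ∀ x ∈ S ∩ U, Function.Surjective (fderiv ℝ g x)

/-- The tangent space `T_p S`: the space of velocities at `p` of smooth curves in `S` through `p`.
(For a submanifold the velocities already form a linear subspace.) -/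
def tangentSpaceAt (S : Set W) (p : W) : Submodule ℝ W :=
  Submodule.span ℝ {v | ∃ γ : ℝ → W, ContDiffAt ℝ ∞ γ 0 ∧ γ 0 = p ∧
    (∀ᶠ t in nhds (0 : ℝ), γ t ∈ S) ∧ HasDerivAt γ v 0}

/-- `φ` restricts to a diffeomorphism from `S` onto `T`. -/
def IsDiffeoOn (φ : V → W) (S : Set V) (T : Set W) : Prop :=
  ∃ ψ : W → V, ContDiffOn ℝ ∞ φ S ∧ ContDiffOn ℝ ∞ ψ T ∧
    Set.MapsTo φ S T ∧ Set.MapsTo ψ T S ∧ Set.InvOn ψ φ S T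

/-- A smooth vector field on the submanifold `Y`. -/
def IsVectorFieldOn (Y : Set W) (X : W → W) : Prop :=
  ContDiffOn ℝ ∞ X Y ∧ ∀ p ∈ Y, X p ∈ tangentSpaceAt Y p

/-- The unit circle in `ℂ`. -/
def unitCircle : Set ℂ := Metric.sphere 0 1

/-- `π : T → S¹` is a smooth fiber bundle with typical fiber `F`: it is smooth and every point of the
circle has an open neighborhood over which `π` is diffeomorphic to the product with `F`. -/
structure IsFiberBundleOverCircle (T F : Set W) (π : W → ℂ) : Prop where
  mapsTo : Set.MapsTo π T unitCircle
  smooth : ContDiffOn ℝ ∞ π T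
  nonempty : F.Nonempty
  locallyTrivial : ∀ w ∈ unitCircle, ∃ A : Set ℂ, IsOpen A ∧ w ∈ A ∧ ∃ Φ : ℂ × W → W,
    IsDiffeoOn Φ ((A ∩ unitCircle) ×ˢ F) (T ∩ π ⁻¹' A) ∧
      ∀ v ∈ A ∩ unitCircle, ∀ q ∈ F, π (Φ (v, q)) = v

/-- `ξ : B × D² → Y` is a trivialization of a tubular neighborhood of `B` in `Y`: a diffeomorphism
onto an open neighborhood of `B` in `Y` that is the identity on the zero section. -/
def IsTrivialTubularNeighborhood (Y B : Set W) (ξ : W × ℂ → W) : Prop :=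
  (∃ O : Set W, IsOpen O ∧ B ⊆ O ∧ IsDiffeoOn ξ (B ×ˢ Metric.ball (0 : ℂ) 1) (Y ∩ O)) ∧
    ∀ b ∈ B, ξ (b, 0) = b

/-- `(B, π)` is an open book decomposition of the closed manifold `Y`: `B` is a closed submanifold of
codimension two with a trivialized tubular neighborhood `ξ : B × D² → Y` on which
`π (ξ (b; r, θ)) = e^{iθ}`, and `π : Y \ B → S¹` is a smooth fiber bundle. -/
structure IsOpenBookDecomposition (Y B : Set W) (π : W → ℂ) : Prop where
  isCompact : IsCompact Y
  binding_subset : B ⊆ Y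
  binding_closed : IsClosed B
  bundle : ∃ c : ℕ, IsEmbeddedSubmanifold c Y ∧ IsEmbeddedSubmanifold (c + 2) B ∧
    ∃ F : Set W, IsEmbeddedSubmanifold (c + 1) F ∧ IsFiberBundleOverCircle (Y \ B) F π
  tubular : ∃ ξ : W × ℂ → W, IsTrivialTubularNeighborhood Y B ξ ∧
    ∀ b ∈ B, ∀ z ∈ Metric.ball (0 : ℂ) 1, z ≠ 0 → π (ξ (b, z)) = z / (‖z‖ : ℂ)

/-- The vector field `X` on `Y` is adapted to the open book `(B, π)`: it is transverse to (the
interior `π⁻¹(e^{iθ})` of) each page, and tangent to the binding `B`. -/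
structure IsAdaptedTo (Y B : Set W) (π : W → ℂ) (X : W → W) : Prop where
  isVectorField : IsVectorFieldOn Y X
  transverse : ∀ p ∈ Y \ B,
    tangentSpaceAt {q ∈ Y \ B | π q = π p} p ⊔ Submodule.span ℝ {X p} = tangentSpaceAt Y p
  tangent : ∀ p ∈ B, X p ∈ tangentSpaceAt B p

end Submanifolds

/-! ### Cotangent bundles of submanifolds of Euclidean space and the geodesic vector field -/

/-- `ℝ^{n+1}` with coordinates `x_0, …, x_n` and the Euclidean inner product. -/
abbrev Euc (n : ℕ) := EuclideanSpace ℝ (Fin (n + 1))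

/-- The cotangent bundle of a submanifold `S` of `ℝ^{n+1}` as a subset of
`T*ℝ^{n+1} = ℝ^{n+1} × ℝ^{n+1}`; covectors are identified with tangent vectors by the metric
induced on `S`. -/
def cotangentBundle {n : ℕ} (S : Set (Euc n)) : Set (Euc n × Euc n) :=
  {p | p.1 ∈ S ∧ p.2 ∈ tangentSpaceAt S p.1}

/-- The unit cotangent bundle `ST*S`. -/
def unitCotangentBundle {n : ℕ} (S : Set (Euc n)) : Set (Euc n × Euc n) :=
  {p ∈ cotangentBundle S | ‖p.2‖ = 1}

/-- The canonical symplectic form `∑ dx_i ∧ dy_i` on `T*ℝ^{n+1}`. -/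
def canonicalForm {n : ℕ} (u v : Euc n × Euc n) : ℝ :=
  ∑ i, (u.1 i * v.2 i - u.2 i * v.1 i)

/-- The Hamiltonian `H(x, y) = (‖y‖² - 1) / 2`. -/
def kineticHamiltonian {n : ℕ} (p : Euc n × Euc n) : ℝ := (‖p.2‖ ^ 2 - 1) / 2

/-- `X` is the geodesic vector field `X_H` on `T*S`, i.e. the Hamiltonian vector field of `H|_{T*S}`
with respect to the canonical symplectic form `ω` of `T*S`, which is the restriction of the canonical
form of `T*ℝ^{n+1}`: `X` is tangent to `T*S`, and `ω(X, v) = dH(v)` for all `v` tangent to `T*S`.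
(Only the values of `X` on `T*S` matter.) -/
def IsGeodesicVectorField {n : ℕ} (S : Set (Euc n)) (X : Euc n × Euc n → Euc n × Euc n) : Prop :=
  ∀ p ∈ cotangentBundle S, X p ∈ tangentSpaceAt (cotangentBundle S) p ∧
    ∀ v ∈ tangentSpaceAt (cotangentBundle S) p,
      canonicalForm (X p) v = fderiv ℝ kineticHamiltonian p v

/-! ### Hypersurfaces in Euclidean space and the symmetric section -/

/-- The level set `M = f⁻¹(0)`. -/
def levelHypersurface {n : ℕ} (f : Euc n → ℝ) : Set (Euc n) := {x | f x = 0}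

/-- `N = M ∩ {x_0 = 0}`. -/
def equator {n : ℕ} (f : Euc n → ℝ) : Set (Euc n) := {x ∈ levelHypersurface f | x 0 = 0}

/-- The reflection `(x_0, x_1, …, x_n) ↦ (-x_0, x_1, …, x_n)`. -/
def reflectZero {n : ℕ} (x : Euc n) : Euc n := WithLp.toLp 2 (Function.update x.ofLp 0 (-x 0))

/-- For every point `x` of `M` with `|x_0|` small enough, `f(x_0, x⃗) = f(-x_0, x⃗)`. -/
def IsSymmetricNearEquator {n : ℕ} (f : Euc n → ℝ) : Prop :=
  ∃ δ : ℝ, 0 < δ ∧ ∀ x ∈ levelHypersurface f, |x 0| < δ → f x = f (reflectZero x)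

/-- `Hess(f)_x(y, y)`. -/
def hessianForm {n : ℕ} (f : Euc n → ℝ) (x y : Euc n) : ℝ := fderiv ℝ (fderiv ℝ f) x y y

/-- `Hess(f)_x(y, y) > 0` for all `(x, y) ∈ T*M` with `y ≠ 0`. -/
def HasPositiveHessian {n : ℕ} (f : Euc n → ℝ) : Prop :=
  ∀ p ∈ cotangentBundle (levelHypersurface f), p.2 ≠ 0 → 0 < hessianForm f p.1 p.2

/-- The map `π(x, y) = (x_0 + i y_0) / |x_0 + i y_0|`. -/
def bookMap {n : ℕ} (p : Euc n × Euc n) : ℂ :=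
  (⟨p.1 0, p.2 0⟩ : ℂ) / (‖(⟨p.1 0, p.2 0⟩ : ℂ)‖ : ℂ)

/-- The angular form `Θ = i · d log π = (y_0 dx_0 - x_0 dy_0) / (x_0² + y_0²)`. -/
def angularForm {n : ℕ} (p v : Euc n × Euc n) : ℝ :=
  (p.2 0 * v.1 0 - p.1 0 * v.2 0) / (p.1 0 ^ 2 + p.2 0 ^ 2)

end

/-!
Write `M = f⁻¹(0)`, `Y = ST*M`, `B = ST*N`, and let `ν = ∇f/‖∇f‖` be the unit normal of `M`.

*Convexity.* The set `{f ≤ 0}` is convex, and lies strictly on one side of each tangent hyperplane of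
`M` (`convex_neg`, `fderiv_sub_neg`): as `M` is connected, so is `{f < 0}`, and the pairs of points
joined by a segment in `{f < 0}` form an open and closed set of pairs, since a limit of such segments
could only touch `M` tangentially, where `f` is strictly convex. Together with the symmetry this shows
that `∂f/∂x₀` vanishes on `N` and that `x₀ ∂f/∂x₀ ≥ c x₀²` on `M` for some `c > 0`
(`IsConvexSymmetric.exists_mul_sq_le`).

*The geodesic field* is `X = (y, -λ ∇f)` with `λ = Hess f(y,y)/‖∇f‖²`, whence
`Θ(X) = (y₀² + λ x₀ ∂f/∂x₀)/(x₀² + y₀²)`, which is bounded below by compactness. All tangent spaces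
that occur are kernels of the derivatives of explicit equations
(`mem_tangentSpaceAt_iff_of_equations`), and `Θ(X) > 0` gives the transversality to the pages.

*The open book.* There is a diffeomorphism from `Y` to the unit cotangent bundle of the round sphere
`Sⁿ` that multiplies `x₀ + i y₀` by a positive function (`IsConvexSymmetric.isBookDiffeo`), so that it
suffices to treat the sphere. It covers the modified Gauss map
`G(x) = (x₀, ν₁, …, νₙ)/‖(x₀, ν₁, …, νₙ)‖`, a diffeomorphism from `M` to `Sⁿ` by convexity, and maps
`T_xM = ν(x)^⊥` to `T_{G(x)}Sⁿ = G(x)^⊥` by the rotation taking `ν(x)` to `G(x)`. That rotation fixes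
the vectors orthogonal to `e₀` and `ν`, and a computation in the plane of `e₀` and `ν` shows that it
scales `y₀` by exactly `1/‖(x₀, ν₁, …, νₙ)‖`.

On the sphere the unit cotangent bundle consists of orthonormal pairs `(u, w)`, that is, of matrices
`A` with two orthonormal rows. Rotating the two rows into each other rotates `u₀ + i w₀`, so the pages
are globally trivialized (`IsBookDiffeo.isFiberBundleOverCircle`), and `A ↦ (1 - c cᵀ)^{1/2} A + c e₀ᵀ`
is the tube about the binding (`tube`, `IsBookDiffeo.exists_tubularNeighborhood`).
-/

/-! ### Regular level sets -/

section LevelSets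

open Filter Topology

variable {W : Type*} [NormedAddCommGroup W] [NormedSpace ℝ W]

/-- A vector killed by a surjective derivative is the velocity of a smooth curve in the level set:
the curve is `t ↦ p + t v + L s(t)` with `L` a right inverse of the derivative, and `s` is found by
inverting `(t, s) ↦ (t, g (p + t v + L s))`. -/
theorem exists_curve_of_mem_ker {F : Type*} [NormedAddCommGroup F] [NormedSpace ℝ F]
    [FiniteDimensional ℝ F] {S : Set W} {p : W} {g : W → F} {g' : W →L[ℝ] F}
    (hg : ContDiffAt ℝ ∞ g p) (hg' : HasFDerivAt g g' p) (hsurj : Function.Surjective g')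
    (hS : ∀ᶠ x in 𝓝 p, g x = 0 → x ∈ S) (hp : g p = 0) {v : W} (hv : g' v = 0) :
    ∃ γ : ℝ → W, ContDiffAt ℝ ∞ γ 0 ∧ γ 0 = p ∧
      (∀ᶠ t in 𝓝 (0 : ℝ), γ t ∈ S) ∧ HasDerivAt γ v 0 := by
  obtain ⟨L₀, hL₀⟩ := LinearMap.exists_rightInverse_of_surjective (g' : W →ₗ[ℝ] F)
    (LinearMap.range_eq_top.2 hsurj)
  let L : F →L[ℝ] W := LinearMap.toContinuousLinearMap L₀
  have hL : ∀ s, g' (L s) = s := fun s => by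
    exact congrArg (fun T : F →ₗ[ℝ] F => T s) hL₀
  let A : ℝ × F →L[ℝ] W :=
    (ContinuousLinearMap.fst ℝ ℝ F).smulRight v + L.comp (ContinuousLinearMap.snd ℝ ℝ F)
  have hA : ∀ q : ℝ × F, A q = q.1 • v + L q.2 := fun q => by simp [A]
  let c : ℝ × F → W := fun q => p + A q
  have hc0 : c 0 = p := by simp [c]
  have hc : ContDiff ℝ ∞ c := contDiff_const.add A.contDiff
  have hc' : HasFDerivAt c A 0 := A.hasFDerivAt.const_add p
  let Φ : ℝ × F → ℝ × F := fun q => (q.1, g (c q))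
  have hΦ : ContDiffAt ℝ ∞ Φ 0 :=
    contDiffAt_fst.prodMk (ContDiffAt.comp (0 : ℝ × F) (by rw [hc0]; exact hg) hc.contDiffAt)
  have hgc : HasFDerivAt (fun q => g (c q)) (g'.comp A) 0 :=
    HasFDerivAt.comp (0 : ℝ × F) (by rw [hc0]; exact hg') hc'
  have hgA : g'.comp A = ContinuousLinearMap.snd ℝ ℝ F := by
    ext q <;> simp [hA, hv, hL]
  have hΦ' : HasFDerivAt Φ ((ContinuousLinearEquiv.refl ℝ (ℝ × F) : (ℝ × F) →L[ℝ] (ℝ × F))) 0 := by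
    have := (hasFDerivAt_fst (𝕜 := ℝ) (p := (0 : ℝ × F))).prodMk hgc
    rw [hgA] at this
    have hid : ((ContinuousLinearEquiv.refl ℝ (ℝ × F) : (ℝ × F) →L[ℝ] (ℝ × F))) =
        (ContinuousLinearMap.fst ℝ ℝ F).prod (ContinuousLinearMap.snd ℝ ℝ F) := by
      ext q <;> simp
    rw [hid]
    exact this
  have h0 : (∞ : WithTop ℕ∞) ≠ 0 := by simp
  let e := hΦ.toOpenPartialHomeomorph Φ hΦ' h0
  let ψ := hΦ.localInverse hΦ' h0
  have hΦ0 : Φ 0 = 0 := by simp [Φ, hc0, hp]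
  have hψ0 : ψ 0 = 0 := by
    have := hΦ.localInverse_apply_image hΦ' h0
    rwa [hΦ0] at this
  have hψ : ContDiffAt ℝ ∞ ψ 0 := by
    have := hΦ.to_localInverse hΦ' h0
    rwa [hΦ0] at this
  have hright : ∀ᶠ q in 𝓝 (0 : ℝ × F), Φ (ψ q) = q := by
    have := (hΦ.hasStrictFDerivAt' hΦ' h0).eventually_right_inverse
    rwa [hΦ0] at this
  have hψ' : HasFDerivAt ψ (ContinuousLinearMap.id ℝ (ℝ × F)) 0 := by
    have := (hΦ.hasStrictFDerivAt' hΦ' h0).to_localInverse.hasFDerivAt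
    rw [hΦ0] at this
    exact this
  let i : ℝ →L[ℝ] ℝ × F := ContinuousLinearMap.inl ℝ ℝ F
  have hi0 : i 0 = 0 := map_zero i
  have hcont : Tendsto (fun t => c (ψ (i t))) (𝓝 0) (𝓝 p) := by
    have h1 : ContinuousAt (fun t => ψ (i t)) 0 :=
      ContinuousAt.comp (by rw [hi0]; exact hψ.continuousAt) i.continuous.continuousAt
    have h2 : ContinuousAt (fun t => c (ψ (i t))) 0 :=
      hc.continuous.continuousAt.comp h1
    have := h2.tendsto
    simpa only [hi0, hψ0, hc0] using this
  refine ⟨fun t => c (ψ (i t)), ?_, by simp [hi0, hψ0, hc0], ?_, ?_⟩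
  · exact hc.contDiffAt.comp (0 : ℝ)
      (ContDiffAt.comp (0 : ℝ) (by rw [hi0]; exact hψ) i.contDiff.contDiffAt)
  · have hi : Tendsto i (𝓝 0) (𝓝 0) := by
      have := i.continuous.tendsto 0
      rwa [hi0] at this
    filter_upwards [hcont.eventually hS, hi.eventually hright] with t h1 h2
    exact h1 (congrArg Prod.snd h2)
  · have h1 : HasFDerivAt (fun t => ψ (i t)) ((ContinuousLinearMap.id ℝ (ℝ × F)).comp i) 0 :=
      HasFDerivAt.comp (0 : ℝ) (by rw [hi0]; exact hψ') i.hasFDerivAt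
    have h2 : HasFDerivAt (fun t => c (ψ (i t)))
        (A.comp ((ContinuousLinearMap.id ℝ (ℝ × F)).comp i)) 0 :=
      HasFDerivAt.comp (g := c) (0 : ℝ) (by rw [hi0, hψ0]; exact hc') h1
    have := h2.hasDerivAt
    simpa [hA, i] using this

/-- The tangent space of a regular level set is the kernel of the derivative of the equations. -/
theorem mem_tangentSpaceAt_iff {F : Type*} [NormedAddCommGroup F] [NormedSpace ℝ F]
    [FiniteDimensional ℝ F] {S : Set W} {p : W} {g : W → F} {g' : W →L[ℝ] F}
    (hg : ContDiffAt ℝ ∞ g p) (hg' : HasFDerivAt g g' p) (hsurj : Function.Surjective g')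
    (hS : ∀ᶠ x in 𝓝 p, x ∈ S ↔ g x = 0) (hp : p ∈ S) {v : W} :
    v ∈ tangentSpaceAt S p ↔ g' v = 0 := by
  constructor
  · intro h
    refine Submodule.span_induction (p := fun v _ => g' v = 0) ?_ (by simp) ?_ ?_ h
    · rintro v ⟨γ, -, hγ0, hγS, hγ'⟩
      have h1 : HasDerivAt (fun t => g (γ t)) (g' v) 0 :=
        HasFDerivAt.comp_hasDerivAt (0 : ℝ) (by rw [hγ0]; exact hg') hγ'
      have hγc : Tendsto γ (𝓝 0) (𝓝 p) := by
        have := hγ'.continuousAt.tendsto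
        rwa [hγ0] at this
      have h2 : (fun t => g (γ t)) =ᶠ[𝓝 0] fun _ => 0 := by
        filter_upwards [hγS, hγc.eventually hS] with t h3 h4 using h4.1 h3
      exact (h1.congr_of_eventuallyEq h2.symm).unique (hasDerivAt_const 0 0)
    · intro x y _ _ hx hy
      simp [hx, hy]
    · intro a x _ hx
      simp [hx]
  · intro hv
    exact Submodule.subset_span (exists_curve_of_mem_ker hg hg' hsurj
      (hS.mono fun x hx => hx.2) (hS.self_of_nhds.1 hp) hv)

/-- The map into `ℝᶜ` with the given components. -/
noncomputable def equations {c : ℕ} (g : Fin c → W → ℝ) (x : W) : EuclideanSpace ℝ (Fin c) :=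
  WithLp.toLp 2 fun i => g i x

/-- The linear map into `ℝᶜ` with the given components. -/
noncomputable def equationsDeriv {c : ℕ} (g' : Fin c → W →L[ℝ] ℝ) : W →L[ℝ] EuclideanSpace ℝ (Fin c) :=
  ((EuclideanSpace.equiv (Fin c) ℝ).symm : (Fin c → ℝ) →L[ℝ] EuclideanSpace ℝ (Fin c)).comp
    (ContinuousLinearMap.pi g')

omit [NormedAddCommGroup W] [NormedSpace ℝ W] in
@[simp] theorem equations_apply {c : ℕ} (g : Fin c → W → ℝ) (x : W) (i : Fin c) :
    equations g x i = g i x := rfl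

@[simp] theorem equationsDeriv_apply {c : ℕ} (g' : Fin c → W →L[ℝ] ℝ) (v : W) (i : Fin c) :
    equationsDeriv g' v i = g' i v := rfl

omit [NormedAddCommGroup W] [NormedSpace ℝ W] in
theorem equations_eq_zero {c : ℕ} {g : Fin c → W → ℝ} {x : W} :
    equations g x = 0 ↔ ∀ i, g i x = 0 := by
  constructor
  · intro h i
    rw [← equations_apply g x i, h]; rfl
  · intro h
    ext i
    simp [h]

theorem equationsDeriv_eq_zero {c : ℕ} {g' : Fin c → W →L[ℝ] ℝ} {v : W} :
    equationsDeriv g' v = 0 ↔ ∀ i, g' i v = 0 := by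
  constructor
  · intro h i
    rw [← equationsDeriv_apply g' v i, h]; rfl
  · intro h
    ext i
    simp [h]

theorem equationsDeriv_surjective {c : ℕ} {g' : Fin c → W →L[ℝ] ℝ}
    (h : ∀ t : Fin c → ℝ, ∃ v, ∀ i, g' i v = t i) :
    Function.Surjective (equationsDeriv g') := by
  intro t
  obtain ⟨v, hv⟩ := h t
  exact ⟨v, by ext i; simp [hv]⟩

theorem hasFDerivAt_equations {c : ℕ} {g : Fin c → W → ℝ} {g' : Fin c → W →L[ℝ] ℝ} {x : W}
    (h : ∀ i, HasFDerivAt (g i) (g' i) x) :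
    HasFDerivAt (equations g) (equationsDeriv g') x :=
  hasFDerivWithinAt_univ.1 (hasFDerivWithinAt_euclidean.2 fun i => (h i).hasFDerivWithinAt)

theorem contDiff_equations {c : ℕ} {g : Fin c → W → ℝ} (h : ∀ i, ContDiff ℝ ∞ (g i)) :
    ContDiff ℝ ∞ (equations g) :=
  contDiff_euclidean.2 h

theorem isEmbeddedSubmanifold_of_equations {c : ℕ} {S U : Set W} {g : Fin c → W → ℝ}
    {g' : Fin c → W → W →L[ℝ] ℝ} (hU : IsOpen U) (hg : ∀ i, ContDiff ℝ ∞ (g i))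
    (hg' : ∀ i x, HasFDerivAt (g i) (g' i x) x)
    (hS : ∀ x, x ∈ S ↔ x ∈ U ∧ ∀ i, g i x = 0)
    (hsurj : ∀ x ∈ S, ∀ t : Fin c → ℝ, ∃ v, ∀ i, g' i x v = t i) :
    IsEmbeddedSubmanifold c S := by
  intro p hp
  refine ⟨U, hU, ((hS p).1 hp).1, equations g, (contDiff_equations hg).contDiffOn, ?_, ?_⟩
  · ext x
    simp only [Set.mem_inter_iff, Set.mem_ofPred_eq, hS, equations_eq_zero]
    tauto
  · intro x hx
    rw [(hasFDerivAt_equations fun i => hg' i x).fderiv]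
    exact equationsDeriv_surjective (hsurj x hx.1)

theorem mem_tangentSpaceAt_iff_of_equations {c : ℕ} {S U : Set W} {g : Fin c → W → ℝ}
    {g' : Fin c → W → W →L[ℝ] ℝ} (hU : IsOpen U) (hg : ∀ i, ContDiff ℝ ∞ (g i))
    (hg' : ∀ i x, HasFDerivAt (g i) (g' i x) x)
    (hS : ∀ x, x ∈ S ↔ x ∈ U ∧ ∀ i, g i x = 0)
    (hsurj : ∀ x ∈ S, ∀ t : Fin c → ℝ, ∃ v, ∀ i, g' i x v = t i) {p v : W} (hp : p ∈ S) :
    v ∈ tangentSpaceAt S p ↔ ∀ i, g' i p v = 0 := by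
  rw [← equationsDeriv_eq_zero]
  refine mem_tangentSpaceAt_iff (contDiff_equations hg).contDiffAt
    (hasFDerivAt_equations fun i => hg' i p) (equationsDeriv_surjective (hsurj p hp)) ?_ hp
  filter_upwards [hU.mem_nhds ((hS p).1 hp).1] with x hx
  rw [hS, equations_eq_zero]
  simp [hx]

end LevelSets

/-! ### Convexity of a sublevel set with positive tangential Hessian -/

section Convexity

open Filter Topology Set

variable {E : Type*} [NormedAddCommGroup E] [NormedSpace ℝ E] {f : E → ℝ}

theorem hasDerivAt_along_line (hf : ContDiff ℝ ∞ f) (x y : E) (t : ℝ) :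
    HasDerivAt (fun t : ℝ => f (x + t • y)) (fderiv ℝ f (x + t • y) y) t := by
  have h1 : HasDerivAt (fun t : ℝ => x + t • y) y t := by
    simpa using ((hasDerivAt_id t).smul_const y).const_add x
  exact ((hf.differentiable (by simp)) _).hasFDerivAt.comp_hasDerivAt t h1

theorem contDiff_fderiv {F : Type*} [NormedAddCommGroup F] [NormedSpace ℝ F] {g : E → F}
    (hg : ContDiff ℝ ∞ g) : ContDiff ℝ ∞ (fderiv ℝ g) :=
  hg.fderiv_right (by simp)

theorem hasDerivAt_fderiv_along_line (hf : ContDiff ℝ ∞ f) (x y : E) (t : ℝ) :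
    HasDerivAt (fun t : ℝ => fderiv ℝ f (x + t • y) y)
      (fderiv ℝ (fderiv ℝ f) (x + t • y) y y) t := by
  have h1 : HasDerivAt (fun t : ℝ => x + t • y) y t := by
    simpa using ((hasDerivAt_id t).smul_const y).const_add x
  have h2 : HasDerivAt (fun t : ℝ => fderiv ℝ f (x + t • y))
      (fderiv ℝ (fderiv ℝ f) (x + t • y) y) t :=
    (((contDiff_fderiv hf).differentiable (by simp)) _).hasFDerivAt.comp_hasDerivAt t h1
  simpa using h2.clm_apply (hasDerivAt_const t y)

theorem eventually_lt_of_hasDerivAt_pos {φ : ℝ → ℝ} {a : ℝ} (h : HasDerivAt φ a 0) (ha : 0 < a) :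
    ∀ᶠ t in 𝓝[>] (0 : ℝ), φ 0 < φ t := by
  have h1 := (hasDerivAt_iff_tendsto_slope.1 h).eventually (lt_mem_nhds ha)
  have h2 : ∀ᶠ t in 𝓝[>] (0 : ℝ), 0 < slope φ 0 t :=
    h1.filter_mono (nhdsWithin_mono _ fun t ht => ne_of_gt ht)
  filter_upwards [h2, self_mem_nhdsWithin] with t h3 h4
  have h5 : (0 : ℝ) < t := h4
  rw [slope_def_field, sub_zero] at h3
  have := (div_pos_iff_of_pos_right h5).1 h3
  linarith

theorem eventually_pos_of_fderiv_pos (hf : ContDiff ℝ ∞ f) {x y : E} (hx : f x = 0)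
    (h : 0 < fderiv ℝ f x y) : ∀ᶠ t in 𝓝[>] (0 : ℝ), 0 < f (x + t • y) := by
  have := eventually_lt_of_hasDerivAt_pos (hasDerivAt_along_line hf x y 0) (by simpa using h)
  simpa [hx] using this

theorem eventually_neg_of_fderiv_neg (hf : ContDiff ℝ ∞ f) {x y : E} (hx : f x = 0)
    (h : fderiv ℝ f x y < 0) : ∀ᶠ t in 𝓝[>] (0 : ℝ), f (x + t • y) < 0 := by
  have := eventually_lt_of_hasDerivAt_pos (hasDerivAt_along_line hf x y 0).neg
    (by simpa using h)
  simpa [hx] using this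

theorem eventually_pos_of_hessian_pos (hf : ContDiff ℝ ∞ f) {x y : E} (hx : f x = 0)
    (h : fderiv ℝ f x y = 0) (h2 : 0 < fderiv ℝ (fderiv ℝ f) x y y) :
    ∀ᶠ t in 𝓝[>] (0 : ℝ), 0 < f (x + t • y) := by
  have h3 := eventually_lt_of_hasDerivAt_pos (hasDerivAt_fderiv_along_line hf x y 0)
    (by simpa using h2)
  simp only [zero_smul, add_zero, h] at h3
  obtain ⟨ε, hε, h4⟩ := mem_nhdsGT_iff_exists_Ioo_subset.1 h3
  filter_upwards [Ioo_mem_nhdsGT hε] with t ht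
  obtain ⟨c, hc, hc'⟩ := exists_hasDerivAt_eq_slope (fun t : ℝ => f (x + t • y))
    (fun t : ℝ => fderiv ℝ f (x + t • y) y) ht.1
    (fun s _ => (hasDerivAt_along_line hf x y s).continuousAt.continuousWithinAt)
    (fun s _ => hasDerivAt_along_line hf x y s)
  have h5 : 0 < fderiv ℝ f (x + c • y) y := h4 ⟨hc.1, hc.2.trans ht.2⟩
  rw [hc'] at h5
  simp only [zero_smul, add_zero, hx, sub_zero] at h5
  exact (div_pos_iff_of_pos_right ht.1).1 h5

/-- Second order estimate along a chord of a level set. -/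
theorem fderiv_le_of_chord (hf : ContDiff ℝ ∞ f) {x w : E} {a c : ℝ} (ha : 0 < a)
    (h : f (x + a • w) = f x)
    (hc : ∀ t ∈ Icc 0 a, c ≤ fderiv ℝ (fderiv ℝ f) (x + t • w) w w) :
    fderiv ℝ f x w ≤ -(c * a / 2) := by
  have hd : ∀ s, HasDerivAt (fun t : ℝ => f (x + t • w) - c * t ^ 2 / 2)
      (fderiv ℝ f (x + s • w) w - c * s) s := fun s => by
    have h2 : HasDerivAt (fun t : ℝ => c * t ^ 2 / 2) (c * s) s := by
      exact (((hasDerivAt_pow 2 s).const_mul c).div_const 2).congr_deriv (by norm_num; ring)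
    exact (hasDerivAt_along_line hf x w s).sub h2
  obtain ⟨η, hη, h1⟩ := exists_hasDerivAt_eq_slope _ _ ha
    (fun s _ => (hd s).continuousAt.continuousWithinAt) (fun s _ => hd s)
  obtain ⟨ζ, hζ, h2⟩ := exists_hasDerivAt_eq_slope _ _ hη.1
    (fun s _ => (hasDerivAt_fderiv_along_line hf x w s).continuousAt.continuousWithinAt)
    (fun s _ => hasDerivAt_fderiv_along_line hf x w s)
  have h3 := hc ζ ⟨hζ.1.le, (hζ.2.trans hη.2).le⟩
  rw [h2, le_div_iff₀ (by linarith [hη.1])] at h3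
  rw [h, eq_div_iff (by linarith)] at h1
  simp only [zero_smul, add_zero, sub_zero] at h1 h3
  have h4 : (fderiv ℝ f (x + η • w) w - c * η + c * a / 2) * a = 0 := by
    linear_combination h1
  have h5 := (mul_eq_zero.1 h4).resolve_right ha.ne'
  linarith

theorem exists_fderiv_neg {x : E} (h : fderiv ℝ f x ≠ 0) : ∃ v, fderiv ℝ f x v < 0 := by
  by_contra! hcon
  apply h
  ext v
  have h1 := hcon v
  have h2 := hcon (-v)
  simp only [map_neg] at h2
  simp only [zero_apply]
  linarith

/-- Near a regular zero of `f`, the set `{f < 0}` is connected: a point of it can be pushed along a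
fixed direction of descent into a ball contained in `{f < 0}`. -/
theorem exists_local_preconnected (hf : ContDiff ℝ ∞ f) {x : E} (hx : f x = 0)
    (hreg : fderiv ℝ f x ≠ 0) :
    ∃ C : Set E, IsPreconnected C ∧ C ⊆ {y | f y < 0} ∧ ∀ᶠ y in 𝓝 x, f y < 0 → y ∈ C := by
  obtain ⟨v, hv⟩ := exists_fderiv_neg hreg
  have hcont : Continuous fun q : E × ℝ => fderiv ℝ f (q.1 + q.2 • v) v :=
    ((contDiff_fderiv hf).continuous.comp
      (continuous_fst.add (continuous_snd.smul continuous_const))).clm_apply continuous_const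
  have h1 : ∀ᶠ q in 𝓝 ((x, 0) : E × ℝ), fderiv ℝ f (q.1 + q.2 • v) v < 0 :=
    hcont.continuousAt.eventually (gt_mem_nhds (by simpa using hv))
  rw [nhds_prod_eq] at h1
  obtain ⟨P, hP, Q, hQ, hPQ⟩ := eventually_prod_iff.1 h1
  obtain ⟨s, hs, hsQ⟩ := Metric.eventually_nhds_iff.1 hQ
  -- `f` decreases along `v` for the times in `[0, s)`, from every point near `x`
  have hdec : ∀ y, P y → ∀ t t', 0 ≤ t → t < t' → t' < s → f (y + t' • v) < f (y + t • v) := by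
    intro y hy t t' h0 htt hts
    obtain ⟨c, hc, hc'⟩ := exists_hasDerivAt_eq_slope (fun t : ℝ => f (y + t • v)) _ htt
      (fun s _ => (hasDerivAt_along_line hf y v s).continuousAt.continuousWithinAt)
      (fun s _ => hasDerivAt_along_line hf y v s)
    have h2 : fderiv ℝ f (y + c • v) v < 0 := by
      refine hPQ hy (hsQ ?_)
      rw [Real.dist_eq, sub_zero, abs_of_nonneg (by linarith [hc.1])]
      linarith [hc.2]
    rw [hc', div_lt_iff₀ (by linarith), zero_mul] at h2
    linarith
  have hxs : f (x + (s / 2) • v) < 0 := by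
    have := hdec x hP.self_of_nhds 0 (s / 2) le_rfl (by linarith) (by linarith)
    simpa [hx] using this
  have h2 : ∀ᶠ y in 𝓝 x, f (y + (s / 2) • v) < 0 := by
    have : Continuous fun y => f (y + (s / 2) • v) :=
      hf.continuous.comp (continuous_id.add continuous_const)
    exact this.continuousAt.eventually (gt_mem_nhds hxs)
  obtain ⟨r, hr, hball⟩ := Metric.eventually_nhds_iff_ball.1 (hP.and h2)
  let T : Set E := (fun y => y + (s / 2) • v) '' Metric.ball x r
  have hT : IsPreconnected T :=
    (convex_ball x r).isPreconnected.image _ (by fun_prop)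
  let L : E → Set E := fun y => (fun t : ℝ => y + t • v) '' Icc 0 (s / 2)
  have hL : ∀ y, IsPreconnected (L y) := fun y =>
    isPreconnected_Icc.image _ (by fun_prop)
  have hLT : ∀ y ∈ Metric.ball x r, y + (s / 2) • v ∈ L y ∩ T := fun y hy =>
    ⟨⟨s / 2, ⟨by linarith, le_rfl⟩, rfl⟩, ⟨y, hy, rfl⟩⟩
  refine ⟨T ∪ ⋃ y ∈ Metric.ball x r ∩ {y | f y < 0}, L y, ?_, ?_, ?_⟩
  · apply isPreconnected_of_forall (x + (s / 2) • v)
    have hxT : x + (s / 2) • v ∈ T := ⟨x, Metric.mem_ball_self hr, rfl⟩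
    rintro y (hy | hy)
    · exact ⟨T, subset_union_left, hxT, hy, hT⟩
    · simp only [mem_iUnion] at hy
      obtain ⟨z, hz, hy⟩ := hy
      refine ⟨T ∪ L z, ?_, Or.inl hxT, Or.inr hy, ?_⟩
      · refine union_subset subset_union_left (subset_union_of_subset_right ?_ _)
        exact subset_biUnion_of_mem (u := L) hz
      · exact IsPreconnected.union _ (hLT z hz.1).2 (hLT z hz.1).1 hT (hL z)
  · rintro y (⟨z, hz, rfl⟩ | hy)
    · exact (hball z hz).2
    · simp only [mem_iUnion] at hy
      obtain ⟨z, hz, t, ht, rfl⟩ := hy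
      rcases ht.1.eq_or_lt with h | h
      · simpa [← h] using hz.2
      · have := hdec z (hball z hz.1).1 0 t le_rfl h (by linarith [ht.2])
        simp only [zero_smul, add_zero] at this
        exact this.trans hz.2
  · filter_upwards [Metric.ball_mem_nhds x hr] with y hy hfy
    refine Or.inr ?_
    simp only [mem_iUnion]
    exact ⟨y, ⟨hy, hfy⟩, 0, ⟨le_rfl, by linarith⟩, by simp⟩

theorem frequently_neg (hf : ContDiff ℝ ∞ f) {x : E} (hx : f x = 0)
    (hreg : fderiv ℝ f x ≠ 0) : ∃ᶠ y in 𝓝 x, f y < 0 := by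
  obtain ⟨v, hv⟩ := exists_fderiv_neg hreg
  have h1 : Tendsto (fun t : ℝ => x + t • v) (𝓝[>] 0) (𝓝 x) := by
    have : Continuous fun t : ℝ => x + t • v := by fun_prop
    have := this.tendsto 0
    simp only [zero_smul, add_zero] at this
    exact this.mono_left nhdsWithin_le_nhds
  exact h1.frequently (eventually_neg_of_fderiv_neg hf hx hv).frequently

/-- If the regular level set `{f = 0}` is connected, then so is `{f < 0}`. -/
theorem isPreconnected_neg (hf : ContDiff ℝ ∞ f) (hreg : ∀ x, f x = 0 → fderiv ℝ f x ≠ 0)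
    (hconn : IsConnected {x | f x = 0}) : IsPreconnected {x | f x < 0} := by
  rw [isPreconnected_iff_subset_of_disjoint]
  intro u v hu hv huv hdisj
  have hU : IsOpen {x | f x < 0} := isOpen_lt hf.continuous continuous_const
  -- if the points of `{f < 0}` near the level set all lie in `a`, the rest is open and closed
  have key : ∀ a b : Set E, IsOpen a → IsOpen b → {x | f x < 0} ⊆ a ∪ b →
      {x | f x < 0} ∩ (a ∩ b) = ∅ →
      (∀ x, f x = 0 → ∀ᶠ y in 𝓝 x, f y < 0 → y ∈ a) → {x | f x < 0} ⊆ a := by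
    intro a b ha hb hab hdis hnear
    have hcl : IsClopen ({x | f x < 0} ∩ b) := by
      refine ⟨⟨?_⟩, hU.inter hb⟩
      rw [isOpen_iff_mem_nhds]
      intro x hx
      rcases lt_trichotomy (f x) 0 with h | h | h
      · have hxa : x ∈ a := (hab h).resolve_right fun hb' => hx ⟨h, hb'⟩
        filter_upwards [ha.mem_nhds hxa] with y hy hy'
        exact (Set.eq_empty_iff_forall_notMem.1 hdis y) ⟨hy'.1, hy, hy'.2⟩
      · filter_upwards [hnear x h] with y hy hy'
        exact (Set.eq_empty_iff_forall_notMem.1 hdis y) ⟨hy'.1, hy hy'.1, hy'.2⟩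
      · filter_upwards [hf.continuous.continuousAt.eventually (lt_mem_nhds h)] with y hy hy'
        exact absurd hy'.1 (not_lt.2 (le_of_lt hy))
    rcases isClopen_iff.1 hcl with h | h
    · intro x hx
      exact (hab hx).resolve_right fun hb' => (Set.eq_empty_iff_forall_notMem.1 h x) ⟨hx, hb'⟩
    · obtain ⟨x, hx⟩ := hconn.nonempty
      have : x ∈ {x | f x < 0} ∩ b := by rw [h]; trivial
      exact absurd this.1 (by have : f x = 0 := hx; simp [this])
  let A : Set E := {x | ∀ᶠ y in 𝓝 x, f y < 0 → y ∈ u}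
  let B : Set E := {x | ∀ᶠ y in 𝓝 x, f y < 0 → y ∈ v}
  have hAB : {x | f x = 0} ⊆ A ∪ B := by
    intro x hx
    obtain ⟨C, hC, hCU, hCx⟩ := exists_local_preconnected hf hx (hreg x hx)
    have hC' := isPreconnected_iff_subset_of_disjoint.1 hC u v hu hv (hCU.trans huv)
      (Set.eq_empty_of_subset_empty (hdisj ▸ inter_subset_inter_left _ hCU))
    rcases hC' with h | h
    · exact Or.inl (hCx.mono fun y hy hy' => h (hy hy'))
    · exact Or.inr (hCx.mono fun y hy hy' => h (hy hy'))
  have hdis : {x | f x = 0} ∩ (A ∩ B) = ∅ := by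
    rw [Set.eq_empty_iff_forall_notMem]
    rintro x ⟨hx, hxA, hxB⟩
    obtain ⟨y, hy, hyu, hyv⟩ :=
      ((frequently_neg hf hx (hreg x hx)).and_eventually (hxA.and hxB)).exists
    exact (Set.eq_empty_iff_forall_notMem.1 hdisj y) ⟨hy, hyu hy, hyv hy⟩
  rcases isPreconnected_iff_subset_of_disjoint.1 hconn.isPreconnected A B
    isOpen_setOfPred_eventually_nhds isOpen_setOfPred_eventually_nhds hAB hdis with h | h
  · exact Or.inl (key u v hu hv huv hdisj fun x hx => h hx)
  · exact Or.inr (key v u hv hu (by rwa [union_comm]) (by rwa [inter_comm v u]) fun x hx => h hx)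

/-- The pairs of points of `{f < 0}` joined by a segment in `{f < 0}` form an open and closed set of
pairs: a limit segment that touches `{f = 0}` is tangent to it, which the Hessian forbids. -/
theorem convex_neg (hf : ContDiff ℝ ∞ f) (hreg : ∀ x, f x = 0 → fderiv ℝ f x ≠ 0)
    (hconn : IsConnected {x | f x = 0})
    (hess : ∀ x y, f x = 0 → fderiv ℝ f x y = 0 → y ≠ 0 → 0 < fderiv ℝ (fderiv ℝ f) x y y) :
    Convex ℝ {x | f x < 0} := by
  let A : Set (E × E) := {p | ∀ t ∈ Icc (0 : ℝ) 1, f (p.1 + t • (p.2 - p.1)) < 0}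
  have hcont : Continuous fun q : (E × E) × ℝ => f (q.1.1 + q.2 • (q.1.2 - q.1.1)) :=
    hf.continuous.comp (by fun_prop)
  have hAopen : IsOpen A := by
    rw [isOpen_iff_eventually]
    intro p hp
    apply isCompact_Icc.eventually_forall_of_forall_eventually
    intro t ht
    exact hcont.continuousAt.eventually (gt_mem_nhds (hp t ht))
  have hUU := (isPreconnected_neg hf hreg hconn).prod (isPreconnected_neg hf hreg hconn)
  have hsub : {x | f x < 0} ×ˢ {x | f x < 0} ⊆ A := by
    rcases Set.eq_empty_or_nonempty {x | f x < 0} with he | ⟨x, hx⟩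
    · simp [he]
    refine hUU.subset_of_closure_inter_subset hAopen ⟨(x, x), ⟨hx, hx⟩, ?_⟩ ?_
    · intro t _
      simpa using hx
    · rintro p ⟨hpA, hp1, hp2⟩ t ht
      have hle : ∀ s ∈ Icc (0 : ℝ) 1, f (p.1 + s • (p.2 - p.1)) ≤ 0 := by
        intro s hs
        have hcl : IsClosed {q : E × E | f (q.1 + s • (q.2 - q.1)) ≤ 0} :=
          isClosed_le (hf.continuous.comp (by fun_prop)) continuous_const
        exact closure_minimal (fun q hq => (hq s hs).le) hcl hpA
      refine (hle t ht).lt_of_ne fun h0 => ?_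
      have hp1' : f p.1 < 0 := hp1
      have hp2' : f p.2 < 0 := hp2
      have ht0 : 0 < t := ht.1.lt_of_ne fun h => by
        rw [← h] at h0; simp at h0; linarith
      have ht1 : t < 1 := ht.2.lt_of_ne fun h => by
        rw [h] at h0; simp at h0; linarith
      have hne : p.2 - p.1 ≠ 0 := fun h => by
        rw [h] at h0; simp at h0; linarith
      have hmax : IsLocalMax (fun s : ℝ => f (p.1 + s • (p.2 - p.1))) t := by
        filter_upwards [Icc_mem_nhds ht0 ht1] with s hs
        rw [h0]
        exact hle s hs
      have hd := hmax.hasDerivAt_eq_zero (hasDerivAt_along_line hf _ _ t)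
      have hpos := eventually_pos_of_hessian_pos hf h0 hd (hess _ _ h0 hd hne)
      obtain ⟨s, hs, hs'⟩ := (hpos.and (Ioo_mem_nhdsGT (sub_pos.2 ht1))).exists
      have := hle (t + s) ⟨by linarith [hs'.1], by linarith [hs'.2]⟩
      rw [add_smul, ← add_assoc] at this
      linarith
  intro x hx y hy a b ha hb hab
  have := hsub (mk_mem_prod hx hy) b ⟨hb, by linarith⟩
  have he : x + b • (y - x) = a • x + b • y := by
    rw [← eq_sub_iff_add_eq] at hab
    rw [hab]; module
  simpa [he] using this

theorem convex_nonpos (hf : ContDiff ℝ ∞ f) (hreg : ∀ x, f x = 0 → fderiv ℝ f x ≠ 0)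
    (hconn : IsConnected {x | f x = 0})
    (hess : ∀ x y, f x = 0 → fderiv ℝ f x y = 0 → y ≠ 0 → 0 < fderiv ℝ (fderiv ℝ f) x y y) :
    Convex ℝ {x | f x ≤ 0} := by
  have : {x | f x ≤ 0} = closure {x | f x < 0} := by
    apply Set.Subset.antisymm
    · intro x hx
      rcases (show f x ≤ 0 from hx).lt_or_eq with h | h
      · exact subset_closure h
      · exact mem_closure_iff_frequently.2 (frequently_neg hf h (hreg x h))
    · exact closure_minimal (fun x (hx : f x < 0) => hx.le) (isClosed_le hf.continuous continuous_const)
  rw [this]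
  exact (convex_neg hf hreg hconn hess).closure

/-- Strict support property: `{f ≤ 0}` lies strictly on one side of each tangent hyperplane. -/
theorem fderiv_sub_neg (hf : ContDiff ℝ ∞ f) (hreg : ∀ x, f x = 0 → fderiv ℝ f x ≠ 0)
    (hconn : IsConnected {x | f x = 0})
    (hess : ∀ x y, f x = 0 → fderiv ℝ f x y = 0 → y ≠ 0 → 0 < fderiv ℝ (fderiv ℝ f) x y y)
    {z x : E} (hz : f z = 0) (hx : f x ≤ 0) (hxz : x ≠ z) : fderiv ℝ f z (x - z) < 0 := by
  have hK := convex_nonpos hf hreg hconn hess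
  by_contra! h
  have hpos : ∀ᶠ t in 𝓝[>] (0 : ℝ), 0 < f (z + t • (x - z)) := by
    rcases h.lt_or_eq with h | h
    · exact eventually_pos_of_fderiv_pos hf hz h
    · exact eventually_pos_of_hessian_pos hf hz h.symm
        (hess _ _ hz h.symm (sub_ne_zero.2 hxz))
  obtain ⟨t, ht, ht'⟩ := (hpos.and (Ioo_mem_nhdsGT zero_lt_one)).exists
  have hmem : z + t • (x - z) ∈ {x | f x ≤ 0} := by
    have := hK (show f z ≤ 0 from hz.le) hx (sub_nonneg.2 ht'.2.le) ht'.1.le (by ring)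
    have he : (1 - t) • z + t • x = z + t • (x - z) := by module
    rwa [he] at this
  exact absurd ht (not_lt.2 hmem)

end Convexity

/-! ### The symmetric section of a convex hypersurface -/

section Equator

open Filter Topology Set

variable {n : ℕ} {f : Euc n → ℝ}

/-- The basis vector `e₀` of `ℝ^{n+1}`. -/
noncomputable def axis (n : ℕ) : Euc n := EuclideanSpace.single 0 1

@[simp] theorem axis_zero : axis n 0 = 1 := by simp [axis]

@[simp] theorem norm_axis : ‖axis n‖ = 1 := by simp [axis]

theorem axis_ne_zero : axis n ≠ 0 := by
  rw [← norm_ne_zero_iff]; simp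

theorem inner_axis (y : Euc n) : inner ℝ y (axis n) = y 0 := by
  simp [axis, EuclideanSpace.inner_single_right]

theorem axis_inner (y : Euc n) : inner ℝ (axis n) y = y 0 := by
  rw [real_inner_comm, inner_axis]

theorem abs_coord_zero_le (y : Euc n) : |y 0| ≤ ‖y‖ := by
  simpa using PiLp.norm_apply_le y 0

theorem reflectZero_eq (x : Euc n) : reflectZero x = x - (2 * x 0) • axis n := by
  ext i
  by_cases hi : i = 0
  · subst hi
    simp [reflectZero]; ring
  · simp [reflectZero, axis, hi]

/-- The hypotheses on `f`, with tangency to the level set expressed by the derivative of `f`. -/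
structure IsConvexSymmetric (f : Euc n → ℝ) : Prop where
  pos : 1 ≤ n
  smooth : ContDiff ℝ ∞ f
  regular : ∀ x, f x = 0 → fderiv ℝ f x ≠ 0
  compact : IsCompact {x | f x = 0}
  connected : IsConnected {x | f x = 0}
  hessian_pos : ∀ x y, f x = 0 → fderiv ℝ f x y = 0 → y ≠ 0 →
    0 < fderiv ℝ (fderiv ℝ f) x y y
  equator_nonempty : ∃ x, f x = 0 ∧ x 0 = 0
  symm : ∃ δ : ℝ, 0 < δ ∧ ∀ x, f x = 0 → |x 0| < δ → f (reflectZero x) = 0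

namespace IsConvexSymmetric

theorem support (h : IsConvexSymmetric f) {z x : Euc n} (hz : f z = 0) (hx : f x ≤ 0)
    (hxz : x ≠ z) : fderiv ℝ f z (x - z) < 0 :=
  fderiv_sub_neg h.smooth h.regular h.connected h.hessian_pos hz hx hxz

/-- If the normal at an equatorial point were not horizontal, there would be a nearby point of the
level set off the equator; by symmetry `f` has equal values at that point and at its mirror image,
and Rolle's theorem gives a nearby zero of `∂f/∂x₀`. -/
theorem fderiv_axis_of_equator (h : IsConvexSymmetric f) {x : Euc n} (hx : f x = 0)
    (hx0 : x 0 = 0) : fderiv ℝ f x (axis n) = 0 := by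
  by_contra hd
  set d := fderiv ℝ f x (axis n) with hd_def
  obtain ⟨δ, hδ, hsymm⟩ := h.symm
  have hcont : Continuous fun y => fderiv ℝ f y (axis n) :=
    (contDiff_fderiv h.smooth).continuous.clm_apply continuous_const
  obtain ⟨r, hr, hball⟩ := Metric.eventually_nhds_iff_ball.1
    (hcont.continuousAt.eventually_ne hd)
  -- a nonzero tangent vector, whose sign is chosen so that moving along it and then along `e`
  -- leaves the hyperplane `x₀ = 0`
  let e : Euc n := -d • axis n
  have he0 : e 0 = -d := by simp [e]
  have he : fderiv ℝ f x e < 0 := by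
    have : fderiv ℝ f x e = -(d * d) := by simp [e, ← hd_def]
    rw [this]
    linarith [mul_self_pos.2 hd]
  have hex : ∃ y : Euc n, fderiv ℝ f x y = 0 ∧ y ≠ 0 ∧ 0 ≤ y 0 * e 0 := by
    have hlast : Fin.last n ≠ 0 := by
      intro hh
      have := congrArg Fin.val hh
      simp at this
      have := h.pos
      omega
    let b : Euc n := EuclideanSpace.single (Fin.last n) 1
    let y : Euc n := b - (fderiv ℝ f x b / d) • axis n
    have hy : fderiv ℝ f x y = 0 := by
      simp only [y, map_sub, map_smul, ← hd_def, smul_eq_mul]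
      field_simp; ring
    have hy0 : y ≠ 0 := by
      intro hh
      have := congrArg (fun v : Euc n => v (Fin.last n)) hh
      simp [y, b, axis, hlast] at this
    rcases le_total 0 (y 0 * e 0) with hs | hs
    · exact ⟨y, hy, hy0, hs⟩
    · exact ⟨-y, by simp [hy], by simpa using hy0, by simp only [PiLp.neg_apply]; linarith⟩
  obtain ⟨y, hy, hy0, hye⟩ := hex
  have hsmall : ∀ v : Euc n, ∀ᶠ t in 𝓝[>] (0 : ℝ), ‖t • v‖ < min r δ / 6 := by
    intro v
    have hc : Continuous fun t : ℝ => ‖t • v‖ := by fun_prop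
    have : ∀ᶠ t in 𝓝 (0 : ℝ), ‖t • v‖ < min r δ / 6 := by
      refine hc.continuousAt.eventually (gt_mem_nhds ?_)
      simp only [zero_smul, norm_zero]
      have := lt_min hr hδ
      linarith
    exact this.filter_mono nhdsWithin_le_nhds
  obtain ⟨s, ⟨hs1, hs2⟩, hs3⟩ := ((eventually_neg_of_fderiv_neg h.smooth hx he).and
    (hsmall e)).and self_mem_nhdsWithin |>.exists
  have hs3 : 0 < s := hs3
  have hcs : ∀ᶠ t in 𝓝[>] (0 : ℝ), f (x + t • y + s • e) < 0 := by
    have hc : Continuous fun t : ℝ => f (x + t • y + s • e) :=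
      h.smooth.continuous.comp (by fun_prop)
    have : ∀ᶠ t in 𝓝 (0 : ℝ), f (x + t • y + s • e) < 0 :=
      hc.continuousAt.eventually (gt_mem_nhds (by simpa using hs1))
    exact this.filter_mono nhdsWithin_le_nhds
  obtain ⟨t, ⟨⟨ht1, ht2⟩, ht3⟩, ht4⟩ := (((eventually_pos_of_hessian_pos h.smooth hx hy
    (h.hessian_pos x y hx hy hy0)).and hcs).and (hsmall y)).and self_mem_nhdsWithin |>.exists
  have ht4 : 0 < t := ht4
  have hc : ContinuousOn (fun s : ℝ => f (x + t • y + s • e)) (Icc 0 s) :=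
    (h.smooth.continuous.comp (by fun_prop)).continuousOn
  obtain ⟨σ, hσ, hσ0⟩ := intermediate_value_Icc' hs3.le hc
    (show (0 : ℝ) ∈ Icc _ _ from ⟨ht2.le, by simpa using ht1.le⟩)
  have hσpos : 0 < σ := hσ.1.lt_of_ne fun hh => by
    simp only [← hh, zero_smul, add_zero] at hσ0
    linarith
  set p := x + t • y + σ • e with hp
  have hσ0 : f p = 0 := hσ0
  have hp0 : p 0 ≠ 0 := by
    intro hh
    have h1 : p 0 = t * y 0 + σ * e 0 := by simp [hp, hx0]
    have h2 : t * (y 0 * e 0) + σ * (e 0 * e 0) = 0 := by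
      have := congrArg (· * e 0) (h1.symm.trans hh)
      simp only [zero_mul] at this
      linear_combination this
    have h3 : 0 < e 0 * e 0 := mul_self_pos.2 (by rw [he0]; simpa using hd)
    have := mul_pos hσpos h3
    have := mul_nonneg ht4.le hye
    linarith
  have hpx : ‖p - x‖ < min r δ / 3 := by
    have h1 : p - x = t • y + σ • e := by rw [hp]; abel
    have h2 : ‖σ • e‖ ≤ ‖s • e‖ := by
      rw [norm_smul σ e, norm_smul s e, Real.norm_eq_abs, Real.norm_eq_abs, abs_of_pos hσpos,
        abs_of_pos hs3]
      exact mul_le_mul_of_nonneg_right hσ.2 (norm_nonneg e)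
    rw [h1]
    linarith [norm_add_le (t • y) (σ • e)]
  have hp0' : |p 0| ≤ ‖p - x‖ := by
    have := abs_coord_zero_le (p - x)
    simpa [hx0] using this
  have hfR := hsymm p hσ0 (by linarith [min_le_right r δ, lt_min hr hδ])
  obtain ⟨τ, hτ, hτ0⟩ := exists_hasDerivAt_eq_zero (f := fun u : ℝ => f (p + u • ((-2 * p 0) • axis n)))
    zero_lt_one (h.smooth.continuous.comp (by fun_prop)).continuousOn (by
      have : p + (-2 * p 0) • axis n = reflectZero p := by rw [reflectZero_eq]; module
      simp only [zero_smul, add_zero, one_smul, this, hσ0, hfR])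
    (fun u _ => hasDerivAt_along_line h.smooth p _ u)
  rw [map_smul, smul_eq_mul, mul_eq_zero] at hτ0
  refine hball _ ?_ (hτ0.resolve_left (by simpa using hp0))
  rw [Metric.mem_ball, dist_eq_norm]
  have h1 : p + τ • ((-2 * p 0) • axis n) - x = (p - x) + (τ * (-2 * p 0)) • axis n := by module
  have h2 : ‖(τ * (-2 * p 0)) • axis n‖ ≤ 2 * |p 0| := by
    rw [norm_smul, norm_axis, mul_one, Real.norm_eq_abs, abs_mul, abs_mul, abs_of_pos hτ.1]
    have := abs_nonneg (p 0)
    have := hτ.2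
    norm_num
    nlinarith [hτ.1]
  rw [h1]
  linarith [norm_add_le (p - x) ((τ * (-2 * p 0)) • axis n), min_le_left r δ]

/-- The outer normal points away from the hyperplane `x₀ = 0`. If the projection `p` of `x` to that
hyperplane lies in the convex set `{f ≤ 0}`, this is the support property at `x`; otherwise the
support property fails at the point where a segment from the equator to `p` leaves `{f ≤ 0}`. -/
theorem mul_fderiv_axis_pos (h : IsConvexSymmetric f) {x : Euc n} (hx : f x = 0)
    (hx0 : x 0 ≠ 0) : 0 < x 0 * fderiv ℝ f x (axis n) := by
  set p := x - x 0 • axis n with hp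
  have hp0 : p 0 = 0 := by simp [hp]
  rcases le_or_gt (f p) 0 with hfp | hfp
  · have hne : p ≠ x := fun hh => hx0 (by rw [← hh, hp0])
    have := h.support hx hfp hne
    have he : p - x = -(x 0 • axis n) := by rw [hp]; abel
    rw [he, map_neg, map_smul, smul_eq_mul] at this
    linarith
  exfalso
  obtain ⟨z₀, hz₀, hz₀0⟩ := h.equator_nonempty
  have hc : Continuous fun t : ℝ => f (z₀ + t • (p - z₀)) :=
    h.smooth.continuous.comp (by fun_prop)
  obtain ⟨T, hT, hTmax⟩ := (isCompact_Icc (a := (0 : ℝ)) (b := 1)).inter_right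
      (isClosed_le hc continuous_const) |>.exists_isGreatest
    ⟨0, ⟨le_rfl, zero_le_one⟩, (by simp [hz₀] : f (z₀ + (0 : ℝ) • (p - z₀)) ≤ 0)⟩
  have hT1 : T < 1 := hT.1.2.lt_of_ne fun hh => by
    have : f (z₀ + T • (p - z₀)) ≤ 0 := hT.2
    rw [hh, one_smul, add_sub_cancel] at this
    linarith
  set z := z₀ + T • (p - z₀) with hz
  have hz0 : z 0 = 0 := by simp [hz, hz₀0, hp0]
  have hev : ∀ᶠ s in 𝓝[>] (0 : ℝ), f (z + s • (p - z)) < 0 := by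
    rcases (show f z ≤ 0 from hT.2).lt_or_eq with hlt | heq
    · have hc' : Continuous fun s : ℝ => f (z + s • (p - z)) :=
        h.smooth.continuous.comp (by fun_prop)
      have : ∀ᶠ s in 𝓝 (0 : ℝ), f (z + s • (p - z)) < 0 :=
        hc'.continuousAt.eventually (gt_mem_nhds (by simpa using hlt))
      exact this.filter_mono nhdsWithin_le_nhds
    · have hne : x ≠ z := fun hh => hx0 (by rw [hh, hz0])
      have h1 := h.support heq hx.le hne
      have h2 : x - z = (p - z) + x 0 • axis n := by rw [hp]; abel
      rw [h2, map_add, map_smul, h.fderiv_axis_of_equator heq hz0, smul_zero, add_zero] at h1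
      exact eventually_neg_of_fderiv_neg h.smooth heq h1
  obtain ⟨s, hs, hs'⟩ := (hev.and (Ioo_mem_nhdsGT zero_lt_one)).exists
  have he : z + s • (p - z) = z₀ + (T + s * (1 - T)) • (p - z₀) := by rw [hz]; module
  have h3 := mul_pos hs'.1 (sub_pos.2 hT1)
  have := hTmax (show T + s * (1 - T) ∈ _ from
    ⟨⟨by linarith [hT.1.1], by nlinarith [hs'.2]⟩, (by rw [← he]; exact hs.le :
      f (z₀ + (T + s * (1 - T)) • (p - z₀)) ≤ 0)⟩)
  linarith

/-- Quantitative form of `IsConvexSymmetric.mul_fderiv_axis_pos`: near the equator the linear term is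
controlled by `∂²f/∂x₀² > 0` along the chord from `x` to its mirror image. -/
theorem exists_mul_sq_le (h : IsConvexSymmetric f) :
    ∃ c : ℝ, 0 < c ∧ ∀ x, f x = 0 → c * x 0 ^ 2 ≤ x 0 * fderiv ℝ f x (axis n) := by
  have key := h.compact.induction_on
    (p := fun s => ∃ c : ℝ, 0 < c ∧ ∀ x ∈ s, f x = 0 → c * x 0 ^ 2 ≤ x 0 * fderiv ℝ f x (axis n))
    ⟨1, one_pos, by simp⟩ ?_ ?_ ?_
  · obtain ⟨c, hc, hc'⟩ := key
    exact ⟨c, hc, fun x hx => hc' x hx hx⟩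
  · rintro s t hst ⟨c, hc, hc'⟩
    exact ⟨c, hc, fun x hx => hc' x (hst hx)⟩
  · rintro s t ⟨c, hc, hcs⟩ ⟨d, hd, hdt⟩
    refine ⟨min c d, lt_min hc hd, ?_⟩
    rintro x (hx | hx) hfx
    · exact (mul_le_mul_of_nonneg_right (min_le_left c d) (sq_nonneg _)).trans (hcs x hx hfx)
    · exact (mul_le_mul_of_nonneg_right (min_le_right c d) (sq_nonneg _)).trans (hdt x hx hfx)
  intro x hx
  have hx : f x = 0 := hx
  by_cases hx0 : x 0 = 0
  · have hpos := h.hessian_pos x (axis n) hx (h.fderiv_axis_of_equator hx hx0) axis_ne_zero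
    set H := fderiv ℝ (fderiv ℝ f) x (axis n) (axis n)
    have hcont : Continuous fun y => fderiv ℝ (fderiv ℝ f) y (axis n) (axis n) :=
      ((contDiff_fderiv (contDiff_fderiv h.smooth)).continuous.clm_apply
        continuous_const).clm_apply continuous_const
    obtain ⟨δ, hδ, hsymm⟩ := h.symm
    obtain ⟨r, hr, hball⟩ := Metric.eventually_nhds_iff_ball.1
      (hcont.continuousAt.eventually (lt_mem_nhds (half_lt_self hpos)))
    refine ⟨Metric.ball x (min r δ / 3), mem_nhdsWithin_of_mem_nhds
      (Metric.ball_mem_nhds _ (by have := lt_min hr hδ; linarith)), H / 2, by linarith, ?_⟩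
    intro y hy hfy
    rw [Metric.mem_ball, dist_eq_norm] at hy
    have hy0 : |y 0| ≤ ‖y - x‖ := by
      have := abs_coord_zero_le (y - x)
      simpa [hx0] using this
    have hR := hsymm y hfy (by linarith [min_le_right r δ, lt_min hr hδ])
    have hnear : ∀ t : ℝ, |t| ≤ 2 * |y 0| →
        H / 2 ≤ fderiv ℝ (fderiv ℝ f) (y + t • axis n) (axis n) (axis n) := by
      intro t ht
      refine (hball _ ?_).le
      rw [Metric.mem_ball, dist_eq_norm]
      have h1 : y + t • axis n - x = (y - x) + t • axis n := by abel
      have h2 : ‖t • axis n‖ = |t| := by rw [norm_smul, norm_axis, mul_one, Real.norm_eq_abs]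
      rw [h1]
      linarith [norm_add_le (y - x) (t • axis n), min_le_left r δ]
    rw [reflectZero_eq] at hR
    rcases lt_trichotomy (y 0) 0 with hlt | heq | hgt
    · have h1 := fderiv_le_of_chord h.smooth (x := y) (w := axis n) (a := -(2 * y 0)) (c := H / 2)
        (by linarith) (by rw [hfy, neg_smul, ← sub_eq_add_neg, hR]) (fun t ht => hnear t (by
          rw [abs_of_neg hlt, abs_of_nonneg ht.1]; linarith [ht.2]))
      nlinarith
    · simp [heq]
    · have h1 := fderiv_le_of_chord h.smooth (x := y) (w := -axis n) (a := 2 * y 0) (c := H / 2)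
        (by linarith) (by rw [hfy, smul_neg, ← sub_eq_add_neg, hR]) (fun t ht => by
          have := hnear (-t) (by rw [abs_of_pos hgt, abs_neg, abs_of_nonneg ht.1]; exact ht.2)
          simpa using this)
      rw [map_neg] at h1
      nlinarith
  · have hpos := h.mul_fderiv_axis_pos hx hx0
    set m := x 0 * fderiv ℝ f x (axis n) with hm
    have hx2 : 0 < x 0 ^ 2 := by positivity
    have hcx : Continuous fun y : Euc n => y 0 := by fun_prop
    have hcont : Continuous fun y : Euc n => y 0 * fderiv ℝ f y (axis n) :=
      hcx.mul ((contDiff_fderiv h.smooth).continuous.clm_apply continuous_const)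
    have h1 : ∀ᶠ y in 𝓝 x, m / 2 < y 0 * fderiv ℝ f y (axis n) :=
      hcont.continuousAt.eventually (lt_mem_nhds (half_lt_self hpos))
    have h2 : ∀ᶠ y in 𝓝 x, y 0 ^ 2 < 2 * x 0 ^ 2 :=
      (hcx.pow 2).continuousAt.eventually (gt_mem_nhds (by show x 0 ^ 2 < _; linarith))
    refine ⟨_, mem_nhdsWithin_of_mem_nhds (h1.and h2), m / (4 * x 0 ^ 2), by positivity, ?_⟩
    rintro y ⟨hy1, hy2⟩ -
    refine le_trans ?_ hy1.le
    rw [div_mul_eq_mul_div, div_le_iff₀ (by positivity)]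
    nlinarith

end IsConvexSymmetric

end Equator

/-! ### Unit cotangent bundles as regular level sets, and the geodesic field -/

section Bundles

open Filter Topology Set

variable {n : ℕ} {f : Euc n → ℝ}

theorem gradient_inner (f : Euc n → ℝ) (x v : Euc n) :
    inner ℝ (gradient f x) v = fderiv ℝ f x v := by
  simp [gradient]

theorem inner_gradient (f : Euc n → ℝ) (x v : Euc n) :
    inner ℝ v (gradient f x) = fderiv ℝ f x v := by
  rw [real_inner_comm, gradient_inner]

theorem gradient_zero_coord (f : Euc n → ℝ) (x : Euc n) :
    gradient f x 0 = fderiv ℝ f x (axis n) := by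
  rw [← inner_axis, gradient_inner]

theorem fderiv_gradient (f : Euc n → ℝ) (x : Euc n) :
    fderiv ℝ f x (gradient f x) = ‖gradient f x‖ ^ 2 := by
  rw [← gradient_inner, real_inner_self_eq_norm_sq]

theorem contDiff_gradient (hf : ContDiff ℝ ∞ f) : ContDiff ℝ ∞ (gradient f) :=
  (InnerProductSpace.toDual ℝ (Euc n)).symm.contDiff.comp (contDiff_fderiv hf)

theorem gradient_ne_zero {x : Euc n} (h : fderiv ℝ f x ≠ 0) : gradient f x ≠ 0 := by
  intro hg
  apply h
  ext v
  rw [← gradient_inner, hg]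
  simp

/-- The three equations `f(x) = 0`, `df_x(y) = 0`, `‖y‖² = 1` of the unit cotangent bundle. -/
noncomputable def unitEqs (f : Euc n → ℝ) : Fin 3 → Euc n × Euc n → ℝ :=
  ![fun p => f p.1, fun p => fderiv ℝ f p.1 p.2, fun p => ‖p.2‖ ^ 2 - 1]

/-- The derivatives of `unitEqs`. -/
noncomputable def unitEqsDeriv (f : Euc n → ℝ) :
    Fin 3 → Euc n × Euc n → (Euc n × Euc n) →L[ℝ] ℝ :=
  ![fun p => (fderiv ℝ f p.1).comp (ContinuousLinearMap.fst ℝ _ _),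
    fun p => ((fderiv ℝ (fderiv ℝ f) p.1).flip p.2).comp (ContinuousLinearMap.fst ℝ _ _) +
      (fderiv ℝ f p.1).comp (ContinuousLinearMap.snd ℝ _ _),
    fun p => (2 : ℝ) • (innerSL ℝ p.2).comp (ContinuousLinearMap.snd ℝ _ _)]

theorem forall_unitEqs {p : Euc n × Euc n} :
    (∀ i, unitEqs f i p = 0) ↔ f p.1 = 0 ∧ fderiv ℝ f p.1 p.2 = 0 ∧ ‖p.2‖ = 1 := by
  have : ‖p.2‖ ^ 2 - 1 = 0 ↔ ‖p.2‖ = 1 := by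
    rw [sub_eq_zero, pow_eq_one_iff_of_nonneg (norm_nonneg _) two_ne_zero]
  simp [unitEqs, Fin.forall_fin_succ, this]

theorem forall_unitEqsDeriv {p v : Euc n × Euc n} {t : Fin 3 → ℝ} :
    (∀ i, unitEqsDeriv f i p v = t i) ↔ fderiv ℝ f p.1 v.1 = t 0 ∧
      fderiv ℝ (fderiv ℝ f) p.1 v.1 p.2 + fderiv ℝ f p.1 v.2 = t 1 ∧
      2 * inner ℝ p.2 v.2 = t 2 := by
  simp [unitEqsDeriv, Fin.forall_fin_succ]

theorem contDiff_fderiv_apply (hf : ContDiff ℝ ∞ f) :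
    ContDiff ℝ ∞ fun p : Euc n × Euc n => fderiv ℝ f p.1 p.2 :=
  ((contDiff_fderiv hf).comp contDiff_fst).clm_apply contDiff_snd

theorem contDiff_unitEqs (hf : ContDiff ℝ ∞ f) (i : Fin 3) : ContDiff ℝ ∞ (unitEqs f i) := by
  revert i
  simp only [Fin.forall_fin_succ, unitEqs]
  refine ⟨hf.comp contDiff_fst, contDiff_fderiv_apply hf, ?_, fun i => i.elim0⟩
  exact (contDiff_snd.norm_sq ℝ).sub contDiff_const

theorem hasFDerivAt_fderiv_apply (hf : ContDiff ℝ ∞ f) (p : Euc n × Euc n) :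
    HasFDerivAt (fun p : Euc n × Euc n => fderiv ℝ f p.1 p.2) (unitEqsDeriv f 1 p) p := by
  have h1 : HasFDerivAt (fun p : Euc n × Euc n => fderiv ℝ f p.1)
      ((fderiv ℝ (fderiv ℝ f) p.1).comp (ContinuousLinearMap.fst ℝ _ _)) p :=
    (((contDiff_fderiv hf).differentiable (by simp)) p.1).hasFDerivAt.comp p hasFDerivAt_fst
  have h2 := h1.clm_apply hasFDerivAt_snd
  refine h2.congr_fderiv ?_
  ext v <;> simp [unitEqsDeriv]

theorem hasFDerivAt_unitEqs (hf : ContDiff ℝ ∞ f) (i : Fin 3) (p : Euc n × Euc n) :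
    HasFDerivAt (unitEqs f i) (unitEqsDeriv f i p) p := by
  revert i
  simp only [Fin.forall_fin_succ]
  refine ⟨?_, hasFDerivAt_fderiv_apply hf p, ?_, fun i => i.elim0⟩
  · exact ((hf.differentiable (by simp)) p.1).hasFDerivAt.comp p hasFDerivAt_fst
  · have h := (HasFDerivAt.norm_sq (hasFDerivAt_snd (𝕜 := ℝ) (p := p))).sub_const 1
    refine h.congr_fderiv ?_
    ext v <;> simp [unitEqsDeriv]

/-- The geodesic field `(y, -(Hess f(y,y)/‖∇f‖²) ∇f)` of the hypersurface. -/
noncomputable def geodesicField (f : Euc n → ℝ) (p : Euc n × Euc n) : Euc n × Euc n :=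
  (p.2, -(fderiv ℝ (fderiv ℝ f) p.1 p.2 p.2 / ‖gradient f p.1‖ ^ 2) • gradient f p.1)

theorem fderiv_geodesicField {p : Euc n × Euc n} (h : fderiv ℝ f p.1 ≠ 0) :
    fderiv ℝ f p.1 (geodesicField f p).2 = -fderiv ℝ (fderiv ℝ f) p.1 p.2 p.2 := by
  have := norm_ne_zero_iff.2 (gradient_ne_zero h)
  simp only [geodesicField, map_smul, fderiv_gradient, smul_eq_mul]
  field_simp

theorem canonicalForm_eq (u v : Euc n × Euc n) :
    canonicalForm u v = inner ℝ u.1 v.2 - inner ℝ u.2 v.1 := by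
  simp [canonicalForm, PiLp.inner_apply, Finset.sum_sub_distrib, mul_comm]

theorem fderiv_kineticHamiltonian (p v : Euc n × Euc n) :
    fderiv ℝ kineticHamiltonian p v = inner ℝ p.2 v.2 := by
  have h := ((HasFDerivAt.norm_sq (hasFDerivAt_snd (𝕜 := ℝ) (p := p))).sub_const 1).mul_const
    ((2 : ℝ)⁻¹)
  have h' : HasFDerivAt (kineticHamiltonian (n := n)) _ p := h
  rw [h'.fderiv]
  simp

theorem mem_tangentSpaceAt_levelHypersurface (hf : ContDiff ℝ ∞ f)
    (hreg : ∀ x, f x = 0 → fderiv ℝ f x ≠ 0) {x v : Euc n} (hx : f x = 0) :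
    v ∈ tangentSpaceAt (levelHypersurface f) x ↔ fderiv ℝ f x v = 0 := by
  refine mem_tangentSpaceAt_iff hf.contDiffAt ((hf.differentiable (by simp)) x).hasFDerivAt ?_
    (Eventually.of_forall fun y => Iff.rfl) hx
  intro a
  have hgr := norm_ne_zero_iff.2 (gradient_ne_zero (hreg x hx))
  exact ⟨(a / ‖gradient f x‖ ^ 2) • gradient f x, by simp [fderiv_gradient, hgr]⟩

theorem mem_cotangentBundle (hf : ContDiff ℝ ∞ f)
    (hreg : ∀ x, f x = 0 → fderiv ℝ f x ≠ 0) {p : Euc n × Euc n} :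
    p ∈ cotangentBundle (levelHypersurface f) ↔ f p.1 = 0 ∧ fderiv ℝ f p.1 p.2 = 0 :=
  and_congr_right fun hx => mem_tangentSpaceAt_levelHypersurface hf hreg hx

namespace IsConvexSymmetric

variable (h : IsConvexSymmetric f)
include h

theorem mem_unitCotangentBundle {p : Euc n × Euc n} :
    p ∈ unitCotangentBundle (levelHypersurface f) ↔
      f p.1 = 0 ∧ fderiv ℝ f p.1 p.2 = 0 ∧ ‖p.2‖ = 1 := by
  simp [unitCotangentBundle, mem_cotangentBundle h.smooth h.regular, and_assoc]

theorem mem_tangentSpaceAt_equator {x v : Euc n} (hx : f x = 0) (hx0 : x 0 = 0) :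
    v ∈ tangentSpaceAt (equator f) x ↔ fderiv ℝ f x v = 0 ∧ v 0 = 0 := by
  let π₀ : Euc n →L[ℝ] ℝ := EuclideanSpace.proj 0
  have hg : ContDiff ℝ ∞ fun y => (f y, π₀ y) := h.smooth.prodMk π₀.contDiff
  have hg' : HasFDerivAt (fun y => (f y, π₀ y)) ((fderiv ℝ f x).prod π₀) x :=
    ((h.smooth.differentiable (by simp)) x).hasFDerivAt.prodMk π₀.hasFDerivAt
  have hgr := norm_ne_zero_iff.2 (gradient_ne_zero (h.regular x hx))
  have hax := h.fderiv_axis_of_equator hx hx0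
  have hmem : x ∈ equator f := ⟨hx, hx0⟩
  rw [mem_tangentSpaceAt_iff hg.contDiffAt hg' ?_ (Eventually.of_forall fun y => ?_) hmem]
  · simp [π₀]
  · rintro ⟨a, b⟩
    refine ⟨(a / ‖gradient f x‖ ^ 2) • gradient f x + b • axis n, ?_⟩
    have h0 : gradient f x 0 = 0 := by rw [gradient_zero_coord, hax]
    ext
    · simp [fderiv_gradient, hax]
      field_simp
    · simp [π₀, h0]
  · simp [equator, levelHypersurface, π₀]

theorem mem_binding {p : Euc n × Euc n} :
    p ∈ unitCotangentBundle (equator f) ↔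
      p ∈ unitCotangentBundle (levelHypersurface f) ∧ p.1 0 = 0 ∧ p.2 0 = 0 := by
  rw [h.mem_unitCotangentBundle]
  constructor
  · rintro ⟨⟨⟨h1, h2⟩, h3⟩, h4⟩
    have := (h.mem_tangentSpaceAt_equator h1 h2).1 h3
    exact ⟨⟨h1, this.1, h4⟩, h2, this.2⟩
  · rintro ⟨⟨h1, h2, h3⟩, h4, h5⟩
    exact ⟨⟨⟨h1, h4⟩, (h.mem_tangentSpaceAt_equator h1 h4).2 ⟨h2, h5⟩⟩, h3⟩

theorem isCompact_unitCotangentBundle :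
    IsCompact (unitCotangentBundle (levelHypersurface f)) := by
  have : unitCotangentBundle (levelHypersurface f) =
      ({x | f x = 0} ×ˢ Metric.sphere (0 : Euc n) 1) ∩
        {p | fderiv ℝ f p.1 p.2 = 0} := by
    ext p
    rw [h.mem_unitCotangentBundle]
    simp
    tauto
  rw [this]
  exact (h.compact.prod (isCompact_sphere _ _)).inter_right
    (isClosed_eq (contDiff_fderiv_apply h.smooth).continuous continuous_const)

theorem isClosed_binding : IsClosed (unitCotangentBundle (equator f)) := by
  have : unitCotangentBundle (equator f) =
      unitCotangentBundle (levelHypersurface f) ∩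
        ({p | p.1 0 = 0} ∩ {p | p.2 0 = 0}) := by
    ext p
    rw [h.mem_binding]
    rfl
  rw [this]
  exact h.isCompact_unitCotangentBundle.isClosed.inter
    ((isClosed_eq (by fun_prop) continuous_const).inter (isClosed_eq (by fun_prop) continuous_const))

theorem exists_unitEqsDeriv_eq {p : Euc n × Euc n}
    (hp : p ∈ unitCotangentBundle (levelHypersurface f)) (t : Fin 3 → ℝ) :
    ∃ v, ∀ i, unitEqsDeriv f i p v = t i := by
  obtain ⟨h1, h2, h3⟩ := h.mem_unitCotangentBundle.1 hp
  have hgr := norm_ne_zero_iff.2 (gradient_ne_zero (h.regular _ h1))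
  simp only [forall_unitEqsDeriv]
  have hgg := fderiv_gradient f p.1
  have hgi := inner_gradient f p.1
  set g := gradient f p.1
  let v : Euc n := (t 0 / ‖g‖ ^ 2) • g
  refine ⟨(v, ((t 1 - fderiv ℝ (fderiv ℝ f) p.1 v p.2) / ‖g‖ ^ 2) • g + (t 2 / 2) • p.2),
    ?_, ?_, ?_⟩
  · simp only [v, map_smul, hgg, smul_eq_mul]
    field_simp
  · simp only [map_add, map_smul, hgg, smul_eq_mul, h2]
    field_simp
    ring
  · simp only [inner_add_right, inner_smul_right, hgi, h2,
      real_inner_self_eq_norm_sq, h3]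
    ring

theorem isEmbeddedSubmanifold_unitCotangentBundle :
    IsEmbeddedSubmanifold 3 (unitCotangentBundle (levelHypersurface f)) :=
  isEmbeddedSubmanifold_of_equations isOpen_univ (contDiff_unitEqs h.smooth)
    (hasFDerivAt_unitEqs h.smooth)
    (fun p => by rw [h.mem_unitCotangentBundle, forall_unitEqs]; simp)
    (fun _ hp t => h.exists_unitEqsDeriv_eq hp t)

theorem mem_tangentSpaceAt_unitCotangentBundle {p v : Euc n × Euc n}
    (hp : p ∈ unitCotangentBundle (levelHypersurface f)) :
    v ∈ tangentSpaceAt (unitCotangentBundle (levelHypersurface f)) p ↔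
      ∀ i, unitEqsDeriv f i p v = 0 :=
  mem_tangentSpaceAt_iff_of_equations isOpen_univ (contDiff_unitEqs h.smooth)
    (hasFDerivAt_unitEqs h.smooth)
    (fun p => by rw [h.mem_unitCotangentBundle, forall_unitEqs]; simp)
    (fun _ hp t => h.exists_unitEqsDeriv_eq hp t) hp

theorem unitEqsDeriv_geodesicField {p : Euc n × Euc n}
    (hp : p ∈ unitCotangentBundle (levelHypersurface f)) (i : Fin 3) :
    unitEqsDeriv f i p (geodesicField f p) = 0 := by
  obtain ⟨h1, h2, h3⟩ := h.mem_unitCotangentBundle.1 hp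
  refine (forall_unitEqsDeriv (t := fun _ => 0)).2 ⟨h2, ?_, ?_⟩ i
  · rw [fderiv_geodesicField (h.regular _ h1)]
    simp [geodesicField]
  · simp only [geodesicField, inner_smul_right, inner_gradient, h2]
    simp

theorem mem_tangentSpaceAt_cotangentBundle {p v : Euc n × Euc n}
    (hp : p ∈ cotangentBundle (levelHypersurface f)) :
    v ∈ tangentSpaceAt (cotangentBundle (levelHypersurface f)) p ↔
      fderiv ℝ f p.1 v.1 = 0 ∧
        fderiv ℝ (fderiv ℝ f) p.1 v.1 p.2 + fderiv ℝ f p.1 v.2 = 0 := by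
  have h1 := ((mem_cotangentBundle h.smooth h.regular).1 hp).1
  have hgr := norm_ne_zero_iff.2 (gradient_ne_zero (h.regular _ h1))
  have hg : ContDiff ℝ ∞ fun q : Euc n × Euc n => (f q.1, fderiv ℝ f q.1 q.2) :=
    (contDiff_unitEqs h.smooth 0).prodMk (contDiff_unitEqs h.smooth 1)
  have hg' : HasFDerivAt (fun q : Euc n × Euc n => (f q.1, fderiv ℝ f q.1 q.2))
      ((unitEqsDeriv f 0 p).prod (unitEqsDeriv f 1 p)) p :=
    (hasFDerivAt_unitEqs h.smooth 0 p).prodMk (hasFDerivAt_unitEqs h.smooth 1 p)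
  rw [mem_tangentSpaceAt_iff hg.contDiffAt hg' ?_ (Eventually.of_forall fun y => ?_) hp]
  · simp [unitEqsDeriv]
  · rintro ⟨a, b⟩
    have hgg := fderiv_gradient f p.1
    set g := gradient f p.1
    let v : Euc n := (a / ‖g‖ ^ 2) • g
    refine ⟨(v, ((b - fderiv ℝ (fderiv ℝ f) p.1 v p.2) / ‖g‖ ^ 2) • g), ?_⟩
    ext
    · simp [unitEqsDeriv, v, hgg]
      field_simp
    · simp [unitEqsDeriv, hgg]
      field_simp
      ring
  · rw [mem_cotangentBundle h.smooth h.regular]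
    simp

theorem isGeodesicVectorField_geodesicField :
    IsGeodesicVectorField (levelHypersurface f) (geodesicField f) := by
  intro p hp
  obtain ⟨h1, h2⟩ := (mem_cotangentBundle h.smooth h.regular).1 hp
  refine ⟨(h.mem_tangentSpaceAt_cotangentBundle hp).2 ⟨h2, ?_⟩, fun v hv => ?_⟩
  · rw [fderiv_geodesicField (h.regular _ h1)]
    simp [geodesicField]
  · have hv1 := ((h.mem_tangentSpaceAt_cotangentBundle hp).1 hv).1
    rw [canonicalForm_eq, fderiv_kineticHamiltonian]
    simp [geodesicField, inner_smul_left, hv1]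

/-- The canonical form is nondegenerate on the cotangent bundle, so the geodesic field is unique. -/
theorem eq_geodesicField {X : Euc n × Euc n → Euc n × Euc n}
    (hX : IsGeodesicVectorField (levelHypersurface f) X) {p : Euc n × Euc n}
    (hp : p ∈ cotangentBundle (levelHypersurface f)) : X p = geodesicField f p := by
  have h1 := ((mem_cotangentBundle h.smooth h.regular).1 hp).1
  have hgr := norm_ne_zero_iff.2 (gradient_ne_zero (h.regular _ h1))
  obtain ⟨hT, hω⟩ := hX p hp
  obtain ⟨hT', hω'⟩ := h.isGeodesicVectorField_geodesicField p hp
  have hZ := sub_mem hT hT'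
  set Z := X p - geodesicField f p with hZdef
  have hZω : ∀ v ∈ tangentSpaceAt (cotangentBundle (levelHypersurface f)) p,
      inner ℝ Z.1 v.2 - inner ℝ Z.2 v.1 = (0 : ℝ) := by
    intro v hv
    have := (hω v hv).trans (hω' v hv).symm
    rw [canonicalForm_eq, canonicalForm_eq] at this
    simp only [hZdef, Prod.fst_sub, Prod.snd_sub, inner_sub_left]
    linarith
  rw [h.mem_tangentSpaceAt_cotangentBundle hp] at hZ
  have hZ1 : Z.1 = 0 := by
    have := hZω (0, Z.1) ((h.mem_tangentSpaceAt_cotangentBundle hp).2 (by simp [hZ.1]))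
    simpa using this
  have hZ2 : fderiv ℝ f p.1 Z.2 = 0 := by simpa [hZ1] using hZ.2
  have hZ3 : Z.2 = 0 := by
    have hgg := fderiv_gradient f p.1
    set g := gradient f p.1
    have := hZω (Z.2, (-(fderiv ℝ (fderiv ℝ f) p.1 Z.2 p.2) / ‖g‖ ^ 2) • g)
      ((h.mem_tangentSpaceAt_cotangentBundle hp).2 ⟨hZ2, by
        simp only [map_smul, hgg, smul_eq_mul]
        field_simp; ring⟩)
    simpa [hZ1] using this
  exact sub_eq_zero.1 (Prod.ext hZ1 hZ3)

theorem contDiffOn_geodesicField :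
    ContDiffOn ℝ ∞ (geodesicField f) (unitCotangentBundle (levelHypersurface f)) := by
  have hgr : ContDiff ℝ ∞ fun p : Euc n × Euc n => gradient f p.1 :=
    (contDiff_gradient h.smooth).comp contDiff_fst
  have hH : ContDiff ℝ ∞ fun p : Euc n × Euc n => fderiv ℝ (fderiv ℝ f) p.1 p.2 p.2 :=
    (((contDiff_fderiv (contDiff_fderiv h.smooth)).comp contDiff_fst).clm_apply
      contDiff_snd).clm_apply contDiff_snd
  refine contDiff_snd.contDiffOn.prodMk
    (ContDiffOn.fun_smul (ContDiffOn.neg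
      (hH.contDiffOn.div (hgr.norm_sq ℝ).contDiffOn fun p hp => ?_)) hgr.contDiffOn)
  have h1 := (h.mem_unitCotangentBundle.1 hp).1
  exact pow_ne_zero 2 (norm_ne_zero_iff.2 (gradient_ne_zero (h.regular _ h1)))

/-- The numerator of the angular form along the geodesic field is bounded below by a multiple of the
denominator: `Θ(X) = (y₀² + λ x₀ ∂f/∂x₀) / (x₀² + y₀²)` with `λ = Hess f(y,y)/‖∇f‖²`. -/
theorem exists_angular_lower_bound : ∃ ε : ℝ, 0 < ε ∧
    ∀ p ∈ unitCotangentBundle (levelHypersurface f), ε * (p.1 0 ^ 2 + p.2 0 ^ 2) ≤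
      p.2 0 * (geodesicField f p).1 0 - p.1 0 * (geodesicField f p).2 0 := by
  obtain ⟨c, hc, hc'⟩ := h.exists_mul_sq_le
  let lam : Euc n × Euc n → ℝ := fun p =>
    fderiv ℝ (fderiv ℝ f) p.1 p.2 p.2 / ‖gradient f p.1‖ ^ 2
  have hlam : ContinuousOn lam (unitCotangentBundle (levelHypersurface f)) := by
    refine ContinuousOn.div ?_ ?_ ?_
    · exact ((((contDiff_fderiv (contDiff_fderiv h.smooth)).comp contDiff_fst).clm_apply
        contDiff_snd).clm_apply contDiff_snd).continuous.continuousOn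
    · exact (((contDiff_gradient h.smooth).comp contDiff_fst).norm_sq ℝ).continuous.continuousOn
    · intro p hp
      have h1 := (h.mem_unitCotangentBundle.1 hp).1
      exact pow_ne_zero 2 (norm_ne_zero_iff.2 (gradient_ne_zero (h.regular _ h1)))
  have hpos : ∀ p ∈ unitCotangentBundle (levelHypersurface f), 0 < lam p := by
    intro p hp
    obtain ⟨h1, h2, h3⟩ := h.mem_unitCotangentBundle.1 hp
    have hgr := norm_pos_iff.2 (gradient_ne_zero (h.regular _ h1))
    have := h.hessian_pos _ _ h1 h2 (by rw [← norm_ne_zero_iff, h3]; exact one_ne_zero)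
    exact div_pos this (by positivity)
  obtain ⟨l, hl, hl'⟩ : ∃ l, 0 < l ∧ ∀ p ∈ unitCotangentBundle (levelHypersurface f),
      l ≤ lam p := by
    rcases (unitCotangentBundle (levelHypersurface f)).eq_empty_or_nonempty with he | hne
    · exact ⟨1, one_pos, by simp [he]⟩
    · obtain ⟨p, hp, hmin⟩ := h.isCompact_unitCotangentBundle.exists_isMinOn hne hlam
      exact ⟨lam p, hpos p hp, fun q hq => hmin hq⟩
  refine ⟨min 1 (l * c), lt_min one_pos (mul_pos hl hc), fun p hp => ?_⟩
  obtain ⟨h1, h2, h3⟩ := h.mem_unitCotangentBundle.1 hp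
  have e1 : (geodesicField f p).1 0 = p.2 0 := rfl
  have e2 : (geodesicField f p).2 0 = -(lam p * fderiv ℝ f p.1 (axis n)) := by
    simp [geodesicField, gradient_zero_coord, lam]
  rw [e1, e2]
  have hx := hc' p.1 h1
  have h4 : l * (c * p.1 0 ^ 2) ≤ lam p * (p.1 0 * fderiv ℝ f p.1 (axis n)) :=
    mul_le_mul (hl' p hp) hx (by positivity) (hpos p hp).le
  have h5 := mul_le_mul_of_nonneg_right (min_le_left 1 (l * c)) (sq_nonneg (p.2 0))
  have h6 := mul_le_mul_of_nonneg_right (min_le_right 1 (l * c)) (sq_nonneg (p.1 0))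
  nlinarith

theorem angular_geodesicField_pos {p : Euc n × Euc n}
    (hp : p ∈ unitCotangentBundle (levelHypersurface f)) (h0 : ¬ (p.1 0 = 0 ∧ p.2 0 = 0)) :
    0 < p.2 0 * (geodesicField f p).1 0 - p.1 0 * (geodesicField f p).2 0 := by
  obtain ⟨ε, hε, hle⟩ := h.exists_angular_lower_bound
  refine lt_of_lt_of_le (mul_pos hε ?_) (hle p hp)
  by_contra! hcon
  have h1 := sq_nonneg (p.1 0)
  have h2 := sq_nonneg (p.2 0)
  exact h0 ⟨pow_eq_zero_iff two_ne_zero |>.1 (by linarith),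
    pow_eq_zero_iff two_ne_zero |>.1 (by linarith)⟩

end IsConvexSymmetric

end Bundles

/-! ### Pages, binding, and transversality of the geodesic field -/

section Pages

open Filter Topology Set

variable {n : ℕ} {f : Euc n → ℝ}

/-- The complex number `x₀ + i y₀`. -/
def bookCoord (p : Euc n × Euc n) : ℂ := ⟨p.1 0, p.2 0⟩

theorem bookMap_eq (p : Euc n × Euc n) : bookMap p = bookCoord p / (‖bookCoord p‖ : ℂ) := rfl

theorem bookCoord_eq_zero {p : Euc n × Euc n} : bookCoord p = 0 ↔ p.1 0 = 0 ∧ p.2 0 = 0 :=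
  Complex.ext_iff

theorem smul_div_norm_eq (z : ℂ) {k : ℝ} (hk : 0 < k) :
    ((k : ℂ) * z) / (‖(k : ℂ) * z‖ : ℂ) = z / (‖z‖ : ℂ) := by
  rw [norm_mul, Complex.norm_real, Real.norm_of_nonneg hk.le, Complex.ofReal_mul]
  exact mul_div_mul_left _ _ (by exact_mod_cast hk.ne')

theorem div_norm_eq_iff {z w : ℂ} (hz : z ≠ 0) (hw : w ≠ 0) :
    z / (‖z‖ : ℂ) = w / (‖w‖ : ℂ) ↔
      w.im * z.re - w.re * z.im = 0 ∧ 0 < w.re * z.re + w.im * z.im := by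
  have hzn : (0 : ℝ) < ‖z‖ := norm_pos_iff.2 hz
  have hwn : (0 : ℝ) < ‖w‖ := norm_pos_iff.2 hw
  have hww : 0 < w.re * w.re + w.im * w.im := by
    rw [← Complex.normSq_apply]; exact Complex.normSq_pos.2 hw
  constructor
  · intro h
    have h1 : z = ((‖z‖ / ‖w‖ : ℝ) : ℂ) * w := by
      rw [div_eq_iff (by exact_mod_cast hzn.ne')] at h
      calc z = w / (‖w‖ : ℂ) * (‖z‖ : ℂ) := h
        _ = ((‖z‖ / ‖w‖ : ℝ) : ℂ) * w := by push_cast; ring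
    have h2 : z.re = ‖z‖ / ‖w‖ * w.re := (congrArg Complex.re h1).trans (Complex.re_ofReal_mul _ _)
    have h3 : z.im = ‖z‖ / ‖w‖ * w.im := (congrArg Complex.im h1).trans (Complex.im_ofReal_mul _ _)
    have hk : 0 < ‖z‖ / ‖w‖ := div_pos hzn hwn
    rw [h2, h3]
    refine ⟨by ring, ?_⟩
    have := mul_pos hk hww
    linarith
  · rintro ⟨h1, h2⟩
    set k := (w.re * z.re + w.im * z.im) / (w.re * w.re + w.im * w.im)
    have hk : 0 < k := div_pos h2 hww
    have h3 : z = (k : ℂ) * w := by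
      apply Complex.ext
      · simp only [Complex.mul_re, Complex.ofReal_re, Complex.ofReal_im, zero_mul, sub_zero, k]
        rw [div_mul_eq_mul_div, eq_div_iff hww.ne']
        linear_combination w.im * h1
      · simp only [Complex.mul_im, Complex.ofReal_re, Complex.ofReal_im, zero_mul, add_zero, k]
        rw [div_mul_eq_mul_div, eq_div_iff hww.ne']
        linear_combination -w.re * h1
    rw [h3]
    exact smul_div_norm_eq w hk

/-- The linear form `b x₀ - a y₀`, which cuts out the page through the direction `(a, b)`. -/
noncomputable def pageForm (n : ℕ) (a b : ℝ) : (Euc n × Euc n) →L[ℝ] ℝ :=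
  b • (EuclideanSpace.proj (0 : Fin (n + 1))).comp (ContinuousLinearMap.fst ℝ (Euc n) (Euc n)) -
    a • (EuclideanSpace.proj (0 : Fin (n + 1))).comp (ContinuousLinearMap.snd ℝ (Euc n) (Euc n))

@[simp] theorem pageForm_apply (a b : ℝ) (v : Euc n × Euc n) :
    pageForm n a b v = b * v.1 0 - a * v.2 0 := by
  simp [pageForm]

/-- The page of the direction `(a, b)`. -/
def pageSet (f : Euc n → ℝ) (a b : ℝ) : Set (Euc n × Euc n) :=
  {q ∈ unitCotangentBundle (levelHypersurface f) |
    pageForm n a b q = 0 ∧ 0 < a * q.1 0 + b * q.2 0}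

namespace IsConvexSymmetric

variable (h : IsConvexSymmetric f)
include h

/-- The equations `x₀ = 0`, `y₀ = 0` are independent of those of `Y` along `B`, because `e₀` is tangent
to the hypersurface there. -/
theorem binding_equations :
    (∀ i, ContDiff ℝ ∞ (Matrix.vecCons (fun q => pageForm n 0 1 q)
      (Matrix.vecCons (fun q => pageForm n (-1) 0 q) (unitEqs f)) i)) ∧
    (∀ i x, HasFDerivAt (Matrix.vecCons (fun q => pageForm n 0 1 q)
        (Matrix.vecCons (fun q => pageForm n (-1) 0 q) (unitEqs f)) i)
      (Matrix.vecCons (fun _ => pageForm n 0 1)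
        (Matrix.vecCons (fun _ => pageForm n (-1) 0) (unitEqsDeriv f)) i x) x) ∧
    (∀ x, x ∈ unitCotangentBundle (equator f) ↔ x ∈ (univ : Set (Euc n × Euc n)) ∧
      ∀ i, Matrix.vecCons (fun q => pageForm n 0 1 q)
        (Matrix.vecCons (fun q => pageForm n (-1) 0 q) (unitEqs f)) i x = 0) ∧
    (∀ x ∈ unitCotangentBundle (equator f), ∀ t : Fin 5 → ℝ,
      ∃ v, ∀ i, Matrix.vecCons (fun _ => pageForm n 0 1)
        (Matrix.vecCons (fun _ => pageForm n (-1) 0) (unitEqsDeriv f)) i x v = t i) := by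
  refine ⟨?_, ?_, ?_, ?_⟩
  · rw [Fin.forall_fin_succ, Fin.forall_fin_succ]
    exact ⟨(pageForm n 0 1).contDiff, (pageForm n (-1) 0).contDiff, contDiff_unitEqs h.smooth⟩
  · rw [Fin.forall_fin_succ, Fin.forall_fin_succ]
    exact ⟨fun x => (pageForm n 0 1).hasFDerivAt, fun x => (pageForm n (-1) 0).hasFDerivAt,
      hasFDerivAt_unitEqs h.smooth⟩
  · intro p
    rw [Fin.forall_fin_succ, Fin.forall_fin_succ]
    simp only [Matrix.cons_val_zero, Matrix.cons_val_succ, forall_unitEqs, h.mem_binding,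
      h.mem_unitCotangentBundle, pageForm_apply]
    simp
    tauto
  · intro p hp t
    rw [h.mem_binding] at hp
    obtain ⟨hpY, hx0, hy0⟩ := hp
    obtain ⟨h1, h2, h3⟩ := h.mem_unitCotangentBundle.1 hpY
    have hgr := norm_ne_zero_iff.2 (gradient_ne_zero (h.regular _ h1))
    have hgg := fderiv_gradient f p.1
    have hgi := inner_gradient f p.1
    have hax := h.fderiv_axis_of_equator h1 hx0
    have hg0 : gradient f p.1 0 = 0 := by rw [gradient_zero_coord, hax]
    set g := gradient f p.1
    obtain ⟨v, hv⟩ := h.exists_unitEqsDeriv_eq hpY (fun i => t i.succ.succ)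
    -- two tangent vectors of `Y` on which `(dx₀, dy₀)` is `(1, 0)` and `(0, 1)`
    let u₁ : Euc n × Euc n :=
      (axis n, (-(fderiv ℝ (fderiv ℝ f) p.1 (axis n) p.2) / ‖g‖ ^ 2) • g)
    let u₂ : Euc n × Euc n := (0, axis n)
    have hu₁ : ∀ i, unitEqsDeriv f i p u₁ = 0 := by
      refine forall_unitEqsDeriv (t := fun _ => 0).2 ⟨hax, ?_, ?_⟩
      · simp only [u₁, map_smul, hgg, smul_eq_mul]
        field_simp
        ring
      · simp only [u₁, inner_smul_right, hgi, h2]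
        simp
    have hu₂ : ∀ i, unitEqsDeriv f i p u₂ = 0 := by
      refine forall_unitEqsDeriv (t := fun _ => 0).2 ⟨?_, ?_, ?_⟩
      · simp [u₂]
      · simp [u₂, hax]
      · simp [u₂, inner_axis, hy0]
    refine ⟨v + (t 0 - v.1 0) • u₁ + (t 1 - v.2 0) • u₂, ?_⟩
    rw [Fin.forall_fin_succ, Fin.forall_fin_succ]
    refine ⟨?_, ?_, fun i => ?_⟩
    · simp [u₁, u₂]
    · simp [u₁, u₂, hg0]
    · simp only [Matrix.cons_val_succ, map_add, map_smul, hu₁, hu₂, hv]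
      simp

theorem isEmbeddedSubmanifold_binding :
    IsEmbeddedSubmanifold 5 (unitCotangentBundle (equator f)) := by
  obtain ⟨h1, h2, h3, h4⟩ := h.binding_equations
  exact isEmbeddedSubmanifold_of_equations isOpen_univ h1 h2 h3 h4

theorem mem_tangentSpaceAt_binding {p v : Euc n × Euc n}
    (hp : p ∈ unitCotangentBundle (equator f)) :
    v ∈ tangentSpaceAt (unitCotangentBundle (equator f)) p ↔
      v.1 0 = 0 ∧ v.2 0 = 0 ∧ ∀ i, unitEqsDeriv f i p v = 0 := by
  obtain ⟨h1, h2, h3, h4⟩ := h.binding_equations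
  rw [mem_tangentSpaceAt_iff_of_equations isOpen_univ h1 h2 h3 h4 hp, Fin.forall_fin_succ,
    Fin.forall_fin_succ]
  simp only [Matrix.cons_val_zero, Matrix.cons_val_succ, pageForm_apply]
  simp

omit h in
/-- The linear form of a page does not vanish on a vector of positive angular speed. -/
theorem pageForm_ne_zero {a b : ℝ} {p X : Euc n × Euc n} (h0 : pageForm n a b p = 0)
    (h1 : 0 < a * p.1 0 + b * p.2 0) (hX : 0 < p.2 0 * X.1 0 - p.1 0 * X.2 0) :
    pageForm n a b X ≠ 0 := by
  intro hX0
  rw [pageForm_apply] at h0 hX0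
  have ha : a * (p.2 0 * X.1 0 - p.1 0 * X.2 0) = 0 := by
    linear_combination -X.1 0 * h0 + p.1 0 * hX0
  have hb : b * (p.2 0 * X.1 0 - p.1 0 * X.2 0) = 0 := by
    linear_combination -X.2 0 * h0 + p.2 0 * hX0
  rw [(mul_eq_zero.1 ha).resolve_right hX.ne', (mul_eq_zero.1 hb).resolve_right hX.ne'] at h1
  simp at h1

theorem pageForm_geodesicField_ne_zero {a b : ℝ} {p : Euc n × Euc n} (hp : p ∈ pageSet f a b) :
    pageForm n a b (geodesicField f p) ≠ 0 := by
  refine pageForm_ne_zero hp.2.1 hp.2.2 (h.angular_geodesicField_pos hp.1 ?_)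
  rintro ⟨h1, h2⟩
  have := hp.2.2
  rw [h1, h2] at this
  simp at this

/-- The equation of a page is independent of those of `Y`, because it does not vanish on the geodesic
field, which is tangent to `Y`. -/
theorem page_equations (a b : ℝ) :
    IsOpen {q : Euc n × Euc n | 0 < a * q.1 0 + b * q.2 0} ∧
    (∀ i, ContDiff ℝ ∞ (Matrix.vecCons (fun q => pageForm n a b q) (unitEqs f) i)) ∧
    (∀ i x, HasFDerivAt (Matrix.vecCons (fun q => pageForm n a b q) (unitEqs f) i)
      (Matrix.vecCons (fun _ => pageForm n a b) (unitEqsDeriv f) i x) x) ∧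
    (∀ x, x ∈ pageSet f a b ↔ x ∈ {q : Euc n × Euc n | 0 < a * q.1 0 + b * q.2 0} ∧
      ∀ i, Matrix.vecCons (fun q => pageForm n a b q) (unitEqs f) i x = 0) ∧
    (∀ x ∈ pageSet f a b, ∀ t : Fin 4 → ℝ,
      ∃ v, ∀ i, Matrix.vecCons (fun _ => pageForm n a b) (unitEqsDeriv f) i x v = t i) := by
  refine ⟨isOpen_lt continuous_const (by fun_prop), ?_, ?_, ?_, ?_⟩
  · rw [Fin.forall_fin_succ]
    exact ⟨(pageForm n a b).contDiff, contDiff_unitEqs h.smooth⟩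
  · rw [Fin.forall_fin_succ]
    exact ⟨fun x => (pageForm n a b).hasFDerivAt, hasFDerivAt_unitEqs h.smooth⟩
  · intro p
    rw [Fin.forall_fin_succ]
    simp only [Matrix.cons_val_zero, Matrix.cons_val_succ, forall_unitEqs, pageSet,
      h.mem_unitCotangentBundle, mem_ofPred_eq]
    tauto
  · intro p hp t
    obtain ⟨v, hv⟩ := h.exists_unitEqsDeriv_eq hp.1 (fun i => t i.succ)
    have hne := h.pageForm_geodesicField_ne_zero hp
    refine ⟨v + ((t 0 - pageForm n a b v) / pageForm n a b (geodesicField f p)) •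
      geodesicField f p, ?_⟩
    rw [Fin.forall_fin_succ]
    refine ⟨?_, fun i => ?_⟩
    · simp only [Matrix.cons_val_zero, map_add, map_smul, smul_eq_mul]
      rw [div_mul_cancel₀ _ hne]
      ring
    · simp only [Matrix.cons_val_succ, map_add, map_smul, hv, h.unitEqsDeriv_geodesicField hp.1]
      simp

theorem isEmbeddedSubmanifold_pageSet (a b : ℝ) : IsEmbeddedSubmanifold 4 (pageSet f a b) := by
  obtain ⟨h1, h2, h3, h4, h5⟩ := h.page_equations a b
  exact isEmbeddedSubmanifold_of_equations h1 h2 h3 h4 h5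

theorem mem_tangentSpaceAt_pageSet {a b : ℝ} {p v : Euc n × Euc n} (hp : p ∈ pageSet f a b) :
    v ∈ tangentSpaceAt (pageSet f a b) p ↔
      pageForm n a b v = 0 ∧ ∀ i, unitEqsDeriv f i p v = 0 := by
  obtain ⟨h1, h2, h3, h4, h5⟩ := h.page_equations a b
  rw [mem_tangentSpaceAt_iff_of_equations h1 h2 h3 h4 h5 hp, Fin.forall_fin_succ]
  rfl

theorem mem_sdiff_binding {p : Euc n × Euc n} :
    p ∈ unitCotangentBundle (levelHypersurface f) \ unitCotangentBundle (equator f) ↔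
      p ∈ unitCotangentBundle (levelHypersurface f) ∧ ¬ (p.1 0 = 0 ∧ p.2 0 = 0) := by
  rw [Set.mem_sdiff, h.mem_binding]
  tauto

theorem page_eq_pageSet {w : ℂ} {a b : ℝ} (hab : ¬ (a = 0 ∧ b = 0))
    (hw : w = (⟨a, b⟩ : ℂ) / (‖(⟨a, b⟩ : ℂ)‖ : ℂ)) :
    {q ∈ unitCotangentBundle (levelHypersurface f) \ unitCotangentBundle (equator f) |
      bookMap q = w} = pageSet f a b := by
  have hab' : (⟨a, b⟩ : ℂ) ≠ 0 := fun hh => hab (Complex.ext_iff.1 hh)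
  ext q
  simp only [mem_ofPred_eq, h.mem_sdiff_binding, pageSet, pageForm_apply]
  constructor
  · rintro ⟨⟨hq, hq0⟩, hqw⟩
    have hq0' : bookCoord q ≠ 0 := fun hh => hq0 (bookCoord_eq_zero.1 hh)
    rw [bookMap_eq, hw, div_norm_eq_iff hq0' hab'] at hqw
    exact ⟨hq, hqw⟩
  · rintro ⟨hq, hq1⟩
    have hq0 : ¬ (q.1 0 = 0 ∧ q.2 0 = 0) := by
      rintro ⟨h1, h2⟩
      have := hq1.2
      simp [h1, h2] at this
    refine ⟨⟨hq, hq0⟩, ?_⟩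
    have hq0' : bookCoord q ≠ 0 := fun hh => hq0 (bookCoord_eq_zero.1 hh)
    rw [bookMap_eq, hw, div_norm_eq_iff hq0' hab']
    exact hq1

theorem isAdaptedTo {X : Euc n × Euc n → Euc n × Euc n}
    (hX : IsGeodesicVectorField (levelHypersurface f) X) :
    IsAdaptedTo (unitCotangentBundle (levelHypersurface f)) (unitCotangentBundle (equator f))
      bookMap X := by
  have hXeq : ∀ p ∈ unitCotangentBundle (levelHypersurface f), X p = geodesicField f p :=
    fun p hp => h.eq_geodesicField hX hp.1
  have hTY : ∀ p ∈ unitCotangentBundle (levelHypersurface f),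
      geodesicField f p ∈ tangentSpaceAt (unitCotangentBundle (levelHypersurface f)) p :=
    fun p hp => (h.mem_tangentSpaceAt_unitCotangentBundle hp).2 (h.unitEqsDeriv_geodesicField hp)
  refine ⟨⟨h.contDiffOn_geodesicField.congr hXeq, fun p hp => ?_⟩, ?_, ?_⟩
  · rw [hXeq p hp]
    exact hTY p hp
  · intro p hp
    have hp' := h.mem_sdiff_binding.1 hp
    have hpage := h.page_eq_pageSet hp'.2 (bookMap_eq p)
    have hpp : p ∈ pageSet f (p.1 0) (p.2 0) := by
      rw [← hpage]
      exact ⟨hp, rfl⟩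
    rw [hpage, hXeq p hp'.1]
    have hne := h.pageForm_geodesicField_ne_zero hpp
    apply le_antisymm
    · refine sup_le ?_ ?_
      · intro v hv
        exact (h.mem_tangentSpaceAt_unitCotangentBundle hp'.1).2
          ((h.mem_tangentSpaceAt_pageSet hpp).1 hv).2
      · rw [Submodule.span_singleton_le_iff_mem]
        exact hTY p hp'.1
    · intro v hv
      rw [h.mem_tangentSpaceAt_unitCotangentBundle hp'.1] at hv
      set ℓ := pageForm n (p.1 0) (p.2 0)
      have : v = (v - (ℓ v / ℓ (geodesicField f p)) • geodesicField f p) +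
          (ℓ v / ℓ (geodesicField f p)) • geodesicField f p := by abel
      rw [this]
      refine Submodule.add_mem_sup ((h.mem_tangentSpaceAt_pageSet hpp).2 ⟨?_, fun i => ?_⟩)
        (Submodule.smul_mem _ _ (Submodule.mem_span_singleton_self _))
      · rw [map_sub, map_smul, smul_eq_mul, div_mul_cancel₀ _ hne, sub_self]
      · rw [map_sub, map_smul, hv, h.unitEqsDeriv_geodesicField hp'.1, smul_zero, sub_zero]
  · intro p hp
    obtain ⟨hpY, hx0, hy0⟩ := h.mem_binding.1 hp
    have h1 := (h.mem_unitCotangentBundle.1 hpY).1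
    rw [hXeq p hpY, h.mem_tangentSpaceAt_binding hp]
    refine ⟨hy0, ?_, h.unitEqsDeriv_geodesicField hpY⟩
    simp [geodesicField, gradient_zero_coord, h.fderiv_axis_of_equator h1 hx0]

end IsConvexSymmetric

end Pages

/-! ### The open book of the unit cotangent bundle of the round sphere -/

section SphereModel

open Filter Topology Set

variable {n : ℕ}

/-- The unit cotangent bundle of the unit sphere: pairs of orthonormal vectors. -/
def sphereBundle (n : ℕ) : Set (Euc n × Euc n) :=
  {p | inner ℝ p.1 p.1 = (1 : ℝ) ∧ inner ℝ p.2 p.2 = (1 : ℝ) ∧ inner ℝ p.1 p.2 = (0 : ℝ)}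

/-- Rotation of the pair `p` by the complex number `v`; the time-`t` geodesic flow of the round
sphere is rotation by `e^{-it}`. -/
noncomputable def rotate (v : ℂ) (p : Euc n × Euc n) : Euc n × Euc n :=
  (v.re • p.1 - v.im • p.2, v.im • p.1 + v.re • p.2)

theorem bookCoord_rotate (v : ℂ) (p : Euc n × Euc n) :
    bookCoord (rotate v p) = v * bookCoord p := by
  apply Complex.ext <;> simp [bookCoord, rotate]
  ring

theorem rotate_rotate (v w : ℂ) (p : Euc n × Euc n) :
    rotate v (rotate w p) = rotate (v * w) p := by
  apply Prod.ext <;> simp only [rotate, Complex.mul_re, Complex.mul_im] <;> module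

theorem rotate_one (p : Euc n × Euc n) : rotate 1 p = p := by
  apply Prod.ext <;> simp [rotate]

theorem rotate_mem {v : ℂ} (hv : ‖v‖ = 1) {p : Euc n × Euc n} (hp : p ∈ sphereBundle n) :
    rotate v p ∈ sphereBundle n := by
  obtain ⟨h1, h2, h3⟩ := hp
  have hv' : v.re * v.re + v.im * v.im = 1 := by
    rw [← Complex.normSq_apply, Complex.normSq_eq_norm_sq, hv, one_pow]
  have h3' : inner ℝ p.2 p.1 = (0 : ℝ) := by rw [real_inner_comm, h3]
  refine ⟨?_, ?_, ?_⟩ <;>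
  simp only [rotate, inner_add_left, inner_add_right, inner_sub_left, inner_sub_right,
    real_inner_smul_left, real_inner_smul_right, h1, h2, h3, h3'] <;>
  linarith

theorem contDiff_re : ContDiff ℝ ∞ Complex.re := Complex.reCLM.contDiff

theorem contDiff_im : ContDiff ℝ ∞ Complex.im := Complex.imCLM.contDiff

theorem contDiff_rotate : ContDiff ℝ ∞ fun q : ℂ × (Euc n × Euc n) => rotate q.1 q.2 := by
  have h1 : ContDiff ℝ ∞ fun q : ℂ × (Euc n × Euc n) => q.1.re := contDiff_re.comp contDiff_fst
  have h2 : ContDiff ℝ ∞ fun q : ℂ × (Euc n × Euc n) => q.1.im := contDiff_im.comp contDiff_fst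
  have h3 : ContDiff ℝ ∞ fun q : ℂ × (Euc n × Euc n) => q.2.1 := contDiff_fst.comp contDiff_snd
  have h4 : ContDiff ℝ ∞ fun q : ℂ × (Euc n × Euc n) => q.2.2 := contDiff_snd.comp contDiff_snd
  exact ((h1.smul h3).sub (h2.smul h4)).prodMk ((h2.smul h3).add (h1.smul h4))

theorem contDiff_bookCoord : ContDiff ℝ ∞ (bookCoord : Euc n × Euc n → ℂ) := by
  have h : (bookCoord : Euc n × Euc n → ℂ) = fun p => Complex.equivRealProdCLM.symm (p.1 0, p.2 0) := by
    funext p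
    apply Complex.ext <;> simp [bookCoord]
  rw [h]
  refine Complex.equivRealProdCLM.symm.contDiff.comp (ContDiff.prodMk ?_ ?_)
  · exact (EuclideanSpace.proj (𝕜 := ℝ) (0 : Fin (n + 1))).contDiff.comp contDiff_fst
  · exact (EuclideanSpace.proj (𝕜 := ℝ) (0 : Fin (n + 1))).contDiff.comp contDiff_snd

theorem contDiffOn_bookMap : ContDiffOn ℝ ∞ (bookMap : Euc n × Euc n → ℂ) {p | bookCoord p ≠ 0} := by
  have h : (bookMap : Euc n × Euc n → ℂ) = fun p => (‖bookCoord p‖⁻¹ : ℝ) • bookCoord p := by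
    funext p
    rw [bookMap_eq, Complex.real_smul, div_eq_inv_mul, Complex.ofReal_inv]
  rw [h]
  exact ((contDiff_bookCoord.contDiffOn.norm ℝ fun p hp => hp).inv
    fun p hp => norm_ne_zero_iff.2 hp).smul contDiff_bookCoord.contDiffOn

theorem norm_bookMap {p : Euc n × Euc n} (hp : bookCoord p ≠ 0) : ‖bookMap p‖ = 1 := by
  rw [bookMap_eq, norm_div, Complex.norm_real, norm_norm, div_self (norm_ne_zero_iff.2 hp)]

theorem bookMap_rotate {v : ℂ} (hv : ‖v‖ = 1) (p : Euc n × Euc n) :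
    bookMap (rotate v p) = v * bookMap p := by
  rw [bookMap_eq, bookMap_eq, bookCoord_rotate, norm_mul, hv, one_mul, mul_div_assoc]

/-- For `κ ∈ ℝ`, `c ∈ ℂ = ℝ²` and a pair `p`, viewed as a matrix with rows `p.1`, `p.2`, this is the
product `(1 + κ c cᵀ) p`. -/
noncomputable def shear (κ : ℝ) (c : ℂ) (p : Euc n × Euc n) : Euc n × Euc n :=
  (p.1 + (κ * c.re) • (c.re • p.1 + c.im • p.2), p.2 + (κ * c.im) • (c.re • p.1 + c.im • p.2))

/-- The pair whose coordinates vanish except for those of index `0`, given by `c`. -/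
noncomputable def axisPair (n : ℕ) (c : ℂ) : Euc n × Euc n := (c.re • axis n, c.im • axis n)

theorem shear_shear {κ μ : ℝ} {c : ℂ}
    (h : κ + μ + κ * μ * (c.re * c.re + c.im * c.im) = 0) (p : Euc n × Euc n) :
    shear κ c (shear μ c p) = p := by
  have key : shear κ c (shear μ c p) =
      shear (κ + μ + κ * μ * (c.re * c.re + c.im * c.im)) c p := by
    apply Prod.ext <;> simp only [shear] <;> module
  rw [key, h]
  simp [shear]

theorem bookCoord_axisPair (c : ℂ) : bookCoord (axisPair n c) = c := by
  apply Complex.ext <;> simp [bookCoord, axisPair]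

theorem bookCoord_add (p q : Euc n × Euc n) : bookCoord (p + q) = bookCoord p + bookCoord q := by
  apply Complex.ext <;> simp [bookCoord]

theorem bookCoord_sub (p q : Euc n × Euc n) : bookCoord (p - q) = bookCoord p - bookCoord q := by
  apply Complex.ext <;> simp [bookCoord]

theorem bookCoord_shear {κ : ℝ} {c : ℂ} {p : Euc n × Euc n} (hp : bookCoord p = 0) :
    bookCoord (shear κ c p) = 0 := by
  rw [bookCoord_eq_zero] at hp ⊢
  simp [shear, hp.1, hp.2]

/-- `√(1 - |c|²)`, the eigenvalue of `(1 - c cᵀ)^{1/2}` in the direction of `c`. -/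
noncomputable def coradius (c : ℂ) : ℝ := √(1 - (c.re * c.re + c.im * c.im))

theorem coradius_pos {c : ℂ} (hc : ‖c‖ < 1) : 0 < coradius c := by
  apply Real.sqrt_pos.2
  rw [← Complex.normSq_apply, Complex.normSq_eq_norm_sq]
  nlinarith [norm_nonneg c]

theorem coradius_sq {c : ℂ} (hc : ‖c‖ < 1) :
    coradius c ^ 2 = 1 - (c.re * c.re + c.im * c.im) := by
  apply Real.sq_sqrt
  rw [← Complex.normSq_apply, Complex.normSq_eq_norm_sq]
  nlinarith [norm_nonneg c]

theorem contDiffOn_coradius : ContDiffOn ℝ ∞ coradius (Metric.ball (0 : ℂ) 1) := by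
  refine ContDiffOn.sqrt ?_ fun c hc => ?_
  · exact (contDiff_const.sub ((contDiff_re.mul contDiff_re).add
      (contDiff_im.mul contDiff_im))).contDiffOn
  · have := coradius_sq (mem_ball_zero_iff.1 hc)
    rw [← this]
    exact (pow_pos (coradius_pos (mem_ball_zero_iff.1 hc)) 2).ne'

/-- The tube about the binding: the orthonormal pair `(1 - c cᵀ)^{1/2} p + c e₀ᵀ`. The square root is
`1 - c cᵀ / (1 + √(1 - |c|²))`, which is smooth at `c = 0`. -/
noncomputable def tube (c : ℂ) (p : Euc n × Euc n) : Euc n × Euc n :=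
  shear (-(1 + coradius c)⁻¹) c p + axisPair n c

/-- The projection onto the binding inverse to `tube`: with `s = √(1 - |c|²)`, the inverse of
`(1 - c cᵀ)^{1/2}` is `1 + c cᵀ / (s (1 + s))`. -/
noncomputable def untube (p : Euc n × Euc n) : Euc n × Euc n :=
  shear (coradius (bookCoord p) * (1 + coradius (bookCoord p)))⁻¹ (bookCoord p)
    (p - axisPair n (bookCoord p))

/-- With `s = √(1 - |c|²)`, `k = 1/(1 + s)` and `l = 1/(s (1 + s))` these identities say that
`(1 - k c cᵀ)² = 1 - c cᵀ`, that `1 + l c cᵀ` is inverse to `1 - k c cᵀ`, and that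
`(1 + l c cᵀ)² (1 - c cᵀ) = 1`. -/
theorem coradius_identities {c : ℂ} (hc : ‖c‖ < 1) {r k l : ℝ}
    (hr : r = c.re * c.re + c.im * c.im) (hk : k = (1 + coradius c)⁻¹)
    (hl : l = (coradius c * (1 + coradius c))⁻¹) :
    2 * k - k ^ 2 * r = 1 ∧ l - k - k * l * r = 0 ∧
      2 * l + l ^ 2 * r - (1 + l * r) ^ 2 = 0 := by
  have hs := coradius_pos hc
  have hs2 := coradius_sq hc
  rw [← hr] at hs2
  have hr' : r = 1 - coradius c ^ 2 := by linarith
  set s := coradius c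
  subst hk hl
  rw [hr']
  have h1 : 1 + s ≠ 0 := by positivity
  refine ⟨?_, ?_, ?_⟩ <;> field_simp <;> ring

theorem bookCoord_tube (c : ℂ) {p : Euc n × Euc n} (hp : bookCoord p = 0) :
    bookCoord (tube c p) = c := by
  rw [tube, bookCoord_add, bookCoord_shear hp, bookCoord_axisPair, zero_add]

theorem untube_tube {c : ℂ} (hc : ‖c‖ < 1) {p : Euc n × Euc n} (hp : bookCoord p = 0) :
    untube (tube c p) = p := by
  obtain ⟨-, h2, -⟩ := coradius_identities hc rfl rfl rfl
  rw [untube, bookCoord_tube c hp, tube, add_sub_cancel_right]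
  apply shear_shear
  linear_combination h2

theorem tube_untube {p : Euc n × Euc n} (hp : ‖bookCoord p‖ < 1) :
    tube (bookCoord p) (untube p) = p := by
  obtain ⟨-, h2, -⟩ := coradius_identities hp rfl rfl rfl
  rw [untube, tube, shear_shear, sub_add_cancel]
  linear_combination h2

theorem bookCoord_untube (p : Euc n × Euc n) : bookCoord (untube p) = 0 := by
  apply bookCoord_shear
  rw [bookCoord_sub, bookCoord_axisPair, sub_self]

theorem tube_mem {c : ℂ} (hc : ‖c‖ < 1) {p : Euc n × Euc n} (hp : p ∈ sphereBundle n)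
    (hp0 : bookCoord p = 0) : tube c p ∈ sphereBundle n := by
  obtain ⟨h1, h2, h3⟩ := hp
  obtain ⟨hk, -, -⟩ := coradius_identities hc rfl rfl rfl
  rw [bookCoord_eq_zero] at hp0
  have h3' : inner ℝ p.2 p.1 = (0 : ℝ) := by rw [real_inner_comm, h3]
  have ha : inner ℝ (axis n) (axis n) = (1 : ℝ) := by rw [inner_axis, axis_zero]
  set k := (1 + coradius c)⁻¹ with hkdef
  refine ⟨?_, ?_, ?_⟩ <;>
  simp only [tube, ← hkdef, shear, axisPair, Prod.fst_add, Prod.snd_add, inner_add_left,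
    inner_add_right, real_inner_smul_left, real_inner_smul_right, h1, h2, h3, h3', ha,
    inner_axis, axis_inner, hp0.1, hp0.2]
  · linear_combination -c.re * c.re * hk
  · linear_combination -c.im * c.im * hk
  · linear_combination -c.re * c.im * hk

theorem untube_mem {p : Euc n × Euc n} (hp : p ∈ sphereBundle n) (hc : ‖bookCoord p‖ < 1) :
    untube p ∈ sphereBundle n := by
  obtain ⟨h1, h2, h3⟩ := hp
  obtain ⟨-, -, hl⟩ := coradius_identities hc rfl rfl rfl
  have h3' : inner ℝ p.2 p.1 = (0 : ℝ) := by rw [real_inner_comm, h3]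
  have ha : inner ℝ (axis n) (axis n) = (1 : ℝ) := by rw [inner_axis, axis_zero]
  set l := (coradius (bookCoord p) * (1 + coradius (bookCoord p)))⁻¹ with hldef
  have hre : (bookCoord p).re = p.1 0 := rfl
  have him : (bookCoord p).im = p.2 0 := rfl
  simp only [hre, him] at hl
  refine ⟨?_, ?_, ?_⟩ <;>
  simp only [untube, ← hldef, shear, axisPair, Prod.fst_sub, Prod.snd_sub, inner_add_left,
    inner_add_right, inner_sub_left, inner_sub_right, real_inner_smul_left,
    real_inner_smul_right, h1, h2, h3, h3', ha, inner_axis, axis_inner, hre, him]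
  · linear_combination p.1 0 * p.1 0 * hl
  · linear_combination p.2 0 * p.2 0 * hl
  · linear_combination p.1 0 * p.2 0 * hl

theorem contDiffOn_shear {E : Type*} [NormedAddCommGroup E] [NormedSpace ℝ E] {S : Set E}
    {κ : E → ℝ} {c : E → ℂ} {p : E → Euc n × Euc n} (hκ : ContDiffOn ℝ ∞ κ S)
    (hc : ContDiffOn ℝ ∞ c S) (hp : ContDiffOn ℝ ∞ p S) :
    ContDiffOn ℝ ∞ (fun x => shear (κ x) (c x) (p x)) S := by
  have h1 := contDiff_re.comp_contDiffOn hc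
  have h2 := contDiff_im.comp_contDiffOn hc
  have h3 := contDiff_fst.comp_contDiffOn hp
  have h4 := contDiff_snd.comp_contDiffOn hp
  have h5 := (h1.smul h3).add (h2.smul h4)
  exact (h3.add ((hκ.mul h1).smul h5)).prodMk (h4.add ((hκ.mul h2).smul h5))

theorem contDiff_axisPair : ContDiff ℝ ∞ (axisPair n) :=
  (contDiff_re.smul contDiff_const).prodMk (contDiff_im.smul contDiff_const)

theorem contDiffOn_tube :
    ContDiffOn ℝ ∞ (fun q : (Euc n × Euc n) × ℂ => tube q.2 q.1)
      (univ ×ˢ Metric.ball (0 : ℂ) 1) := by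
  have hs : ContDiffOn ℝ ∞ (fun q : (Euc n × Euc n) × ℂ => coradius q.2)
      (univ ×ˢ Metric.ball (0 : ℂ) 1) :=
    contDiffOn_coradius.comp contDiff_snd.contDiffOn fun q hq => hq.2
  refine (contDiffOn_shear (ContDiffOn.neg (ContDiffOn.inv (contDiffOn_const.add hs) ?_))
    contDiff_snd.contDiffOn contDiff_fst.contDiffOn).add
    (contDiff_axisPair.comp contDiff_snd).contDiffOn
  intro q hq
  have := coradius_pos (mem_ball_zero_iff.1 hq.2)
  positivity

theorem contDiffOn_untube :
    ContDiffOn ℝ ∞ (untube (n := n)) {p | ‖bookCoord p‖ < 1} := by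
  have hs : ContDiffOn ℝ ∞ (fun p : Euc n × Euc n => coradius (bookCoord p))
      {p | ‖bookCoord p‖ < 1} :=
    contDiffOn_coradius.comp contDiff_bookCoord.contDiffOn fun q hq => mem_ball_zero_iff.2 hq
  refine contDiffOn_shear (ContDiffOn.inv (hs.mul (contDiffOn_const.add hs)) ?_)
    contDiff_bookCoord.contDiffOn
    (contDiff_id.sub (contDiff_axisPair.comp contDiff_bookCoord)).contDiffOn
  intro p hp
  have := coradius_pos (show ‖bookCoord p‖ < 1 from hp)
  positivity

end SphereModel

/-! ### Transfer of the open book -/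

section Transfer

open Filter Topology Set

variable {n : ℕ}

/-- A diffeomorphism from `Y` to the unit cotangent bundle of the sphere (with inverse `ψ`) that
preserves `x₀ + i y₀` up to positive factors, with `B = Y ∩ {x₀ = y₀ = 0}`. -/
structure IsBookDiffeo (Y B : Set (Euc n × Euc n)) (Ψ ψ : Euc n × Euc n → Euc n × Euc n) :
    Prop where
  smooth : ContDiffOn ℝ ∞ Ψ Y
  smooth_inv : ContDiffOn ℝ ∞ ψ (sphereBundle n)
  mapsTo : MapsTo Ψ Y (sphereBundle n)
  mapsTo_inv : MapsTo ψ (sphereBundle n) Y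
  invOn : InvOn ψ Ψ Y (sphereBundle n)
  binding : ∀ p, p ∈ B ↔ p ∈ Y ∧ bookCoord p = 0
  scale : ∀ p ∈ Y, ∃ k : ℝ, 0 < k ∧ bookCoord (Ψ p) = k * bookCoord p

namespace IsBookDiffeo

variable {Y B : Set (Euc n × Euc n)} {Ψ ψ : Euc n × Euc n → Euc n × Euc n}
  (h : IsBookDiffeo Y B Ψ ψ)
include h

theorem bookMap_apply {p : Euc n × Euc n} (hp : p ∈ Y) : bookMap (Ψ p) = bookMap p := by
  obtain ⟨k, hk, hk'⟩ := h.scale p hp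
  rw [bookMap_eq, bookMap_eq, hk', smul_div_norm_eq _ hk]

theorem bookCoord_apply_eq_zero {p : Euc n × Euc n} (hp : p ∈ Y) :
    bookCoord (Ψ p) = 0 ↔ bookCoord p = 0 := by
  obtain ⟨k, hk, hk'⟩ := h.scale p hp
  simp [hk', hk.ne']

theorem bookMap_inv {q : Euc n × Euc n} (hq : q ∈ sphereBundle n) :
    bookMap (ψ q) = bookMap q := by
  rw [← h.bookMap_apply (h.mapsTo_inv hq), h.invOn.2 hq]

theorem bookCoord_inv_eq_zero {q : Euc n × Euc n} (hq : q ∈ sphereBundle n) :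
    bookCoord (ψ q) = 0 ↔ bookCoord q = 0 := by
  rw [← h.bookCoord_apply_eq_zero (h.mapsTo_inv hq), h.invOn.2 hq]

theorem mem_sdiff {p : Euc n × Euc n} : p ∈ Y \ B ↔ p ∈ Y ∧ bookCoord p ≠ 0 := by
  rw [Set.mem_sdiff, h.binding]
  tauto

/-- Rotation of the sphere model trivializes the pages globally. -/
theorem isFiberBundleOverCircle (hn : 1 ≤ n) :
    IsFiberBundleOverCircle (Y \ B) {q ∈ Y \ B | bookMap q = 1} bookMap := by
  have hmem : ∀ {v : ℂ} {p : Euc n × Euc n}, ‖v‖ = 1 → p ∈ Y → bookCoord p ≠ 0 →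
      rotate v (Ψ p) ∈ sphereBundle n ∧ ψ (rotate v (Ψ p)) ∈ Y \ B ∧
      bookMap (ψ (rotate v (Ψ p))) = v * bookMap p := by
    intro v p hv hp hp0
    have h1 := rotate_mem hv (h.mapsTo hp)
    refine ⟨h1, h.mem_sdiff.2 ⟨h.mapsTo_inv h1, ?_⟩, ?_⟩
    · rw [Ne, h.bookCoord_inv_eq_zero h1, bookCoord_rotate, mul_eq_zero,
        h.bookCoord_apply_eq_zero hp, not_or]
      exact ⟨norm_ne_zero_iff.1 (by rw [hv]; exact one_ne_zero), hp0⟩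
    · rw [h.bookMap_inv h1, bookMap_rotate hv, h.bookMap_apply hp]
  have hcirc : ∀ {v : ℂ}, v ∈ unitCircle ↔ ‖v‖ = 1 := by simp [unitCircle]
  have hsm : ContDiffOn ℝ ∞ (bookMap : Euc n × Euc n → ℂ) (Y \ B) :=
    contDiffOn_bookMap.mono fun p hp => (h.mem_sdiff.1 hp).2
  have hconj : ∀ {v : ℂ}, ‖v‖ = 1 → starRingEnd ℂ v * v = 1 := by
    intro v hv
    rw [Complex.conj_mul', hv]; simp
  refine ⟨fun p hp => hcirc.2 (norm_bookMap (h.mem_sdiff.1 hp).2), hsm, ?_, ?_⟩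
  · have hlast : Fin.last n ≠ 0 := by
      intro hh
      have := congrArg Fin.val hh
      simp at this
      omega
    let b : Euc n := EuclideanSpace.single (Fin.last n) 1
    have hb0 : b 0 = 0 := by simp [b, hlast.symm]
    have hu : (axis n, b) ∈ sphereBundle n := by
      refine ⟨by rw [inner_axis, axis_zero], ?_, by rw [axis_inner, hb0]⟩
      rw [real_inner_self_eq_norm_sq]
      simp [b]
    have hc : bookCoord (axis n, b) = 1 := by
      apply Complex.ext <;> simp [bookCoord, hb0]
    refine ⟨ψ (axis n, b), h.mem_sdiff.2 ⟨h.mapsTo_inv hu, ?_⟩, ?_⟩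
    · rw [Ne, h.bookCoord_inv_eq_zero hu, hc]
      exact one_ne_zero
    · rw [h.bookMap_inv hu, bookMap_eq, hc]
      simp
  · intro w _
    refine ⟨univ, isOpen_univ, trivial, fun q => ψ (rotate q.1 (Ψ q.2)),
      ⟨fun p => (bookMap p, ψ (rotate (starRingEnd ℂ (bookMap p)) (Ψ p))), ?_, ?_, ?_, ?_, ?_, ?_⟩,
      ?_⟩
    · refine h.smooth_inv.comp (t := sphereBundle n) ?_ ?_
      · exact contDiff_rotate.comp_contDiffOn (contDiff_fst.contDiffOn.prodMk
          (h.smooth.comp contDiff_snd.contDiffOn fun q hq => hq.2.1.1))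
      · intro q hq
        exact (hmem (hcirc.1 hq.1.2) hq.2.1.1 (h.mem_sdiff.1 hq.2.1).2).1
    · refine (hsm.mono inter_subset_left).prodMk (h.smooth_inv.comp (t := sphereBundle n) ?_ ?_)
      · exact contDiff_rotate.comp_contDiffOn ((Complex.conjCLE.contDiff.comp_contDiffOn
          (hsm.mono inter_subset_left)).prodMk (h.smooth.mono fun p hp => hp.1.1))
      · intro p hp
        have hp' := h.mem_sdiff.1 hp.1
        exact (hmem (by rw [Complex.norm_conj, norm_bookMap hp'.2]) hp'.1 hp'.2).1
    · intro q hq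
      exact ⟨(hmem (hcirc.1 hq.1.2) hq.2.1.1 (h.mem_sdiff.1 hq.2.1).2).2.1, trivial⟩
    · intro p hp
      have hp' := h.mem_sdiff.1 hp.1
      have hv : ‖starRingEnd ℂ (bookMap p)‖ = 1 := by rw [Complex.norm_conj, norm_bookMap hp'.2]
      have := hmem hv hp'.1 hp'.2
      refine ⟨⟨trivial, hcirc.2 (norm_bookMap hp'.2)⟩, this.2.1, ?_⟩
      rw [this.2.2, hconj (norm_bookMap hp'.2)]
    · rintro ⟨v, q⟩ ⟨⟨-, hv⟩, hq, hq1⟩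
      have hq' := h.mem_sdiff.1 hq
      have hv := hcirc.1 hv
      have hm := hmem hv hq'.1 hq'.2
      rw [hq1, mul_one] at hm
      refine Prod.ext hm.2.2 ?_
      simp only [hm.2.2]
      rw [h.invOn.2 hm.1, rotate_rotate, hconj hv, rotate_one, h.invOn.1 hq'.1]
    · intro p hp
      have hp' := h.mem_sdiff.1 hp.1
      have hn1 := norm_bookMap hp'.2
      have hv : ‖starRingEnd ℂ (bookMap p)‖ = 1 := by rw [Complex.norm_conj, hn1]
      have hm := hmem hv hp'.1 hp'.2
      simp only
      rw [h.invOn.2 hm.1, rotate_rotate, mul_comm, hconj hn1, rotate_one, h.invOn.1 hp'.1]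
    · intro v hv q hq
      have hq' := h.mem_sdiff.1 hq.1
      rw [(hmem (hcirc.1 hv.2) hq'.1 hq'.2).2.2, hq.2, mul_one]

theorem exists_tubularNeighborhood {O : Set (Euc n × Euc n)} (hO : IsOpen O)
    (hYO : ∀ p ∈ Y, p ∈ O ↔ ‖bookCoord (Ψ p)‖ < 1) :
    ∃ ξ : (Euc n × Euc n) × ℂ → Euc n × Euc n, IsTrivialTubularNeighborhood Y B ξ ∧
      ∀ b ∈ B, ∀ z ∈ Metric.ball (0 : ℂ) 1, z ≠ 0 → bookMap (ξ (b, z)) = z / (‖z‖ : ℂ) := by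
  have hB : ∀ {b}, b ∈ B → b ∈ Y ∧ bookCoord (Ψ b) = 0 := fun {b} hb => by
    obtain ⟨h1, h2⟩ := (h.binding b).1 hb
    exact ⟨h1, (h.bookCoord_apply_eq_zero h1).2 h2⟩
  have htube : ∀ {b} {z : ℂ}, b ∈ B → ‖z‖ < 1 → tube z (Ψ b) ∈ sphereBundle n :=
    fun hb hz => tube_mem hz (h.mapsTo (hB hb).1) (hB hb).2
  have huntube : ∀ {p}, p ∈ Y ∩ O → ‖bookCoord (Ψ p)‖ < 1 ∧
      untube (Ψ p) ∈ sphereBundle n ∧ ψ (untube (Ψ p)) ∈ B := by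
    intro p hp
    have h1 := (hYO p hp.1).1 hp.2
    have h2 := untube_mem (h.mapsTo hp.1) h1
    refine ⟨h1, h2, (h.binding _).2 ⟨h.mapsTo_inv h2, ?_⟩⟩
    rw [h.bookCoord_inv_eq_zero h2, bookCoord_untube]
  refine ⟨fun q => ψ (tube q.2 (Ψ q.1)), ⟨⟨O, hO, ?_,
    fun p => (ψ (untube (Ψ p)), bookCoord (Ψ p)), ?_, ?_, ?_, ?_, ?_, ?_⟩, ?_⟩, ?_⟩
  · intro b hb
    rw [hYO b (hB hb).1, (hB hb).2, norm_zero]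
    exact one_pos
  · refine h.smooth_inv.comp (t := sphereBundle n) ?_ ?_
    · exact contDiffOn_tube.comp ((h.smooth.comp contDiff_fst.contDiffOn
        fun q hq => (hB hq.1).1).prodMk contDiff_snd.contDiffOn) fun q hq => ⟨trivial, hq.2⟩
    · exact fun q hq => htube hq.1 (mem_ball_zero_iff.1 hq.2)
  · have hΨ := h.smooth.mono (inter_subset_left : Y ∩ O ⊆ Y)
    refine ContDiffOn.prodMk (h.smooth_inv.comp (t := sphereBundle n) ?_ ?_)
      (contDiff_bookCoord.comp_contDiffOn hΨ)
    · exact contDiffOn_untube.comp hΨ fun p hp => (huntube hp).1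
    · exact fun p hp => (huntube hp).2.1
  · intro q hq
    have hz := mem_ball_zero_iff.1 hq.2
    have h1 := htube hq.1 hz
    refine ⟨h.mapsTo_inv h1, (hYO _ (h.mapsTo_inv h1)).2 ?_⟩
    rw [h.invOn.2 h1, bookCoord_tube _ (hB hq.1).2]
    exact hz
  · exact fun p hp => ⟨(huntube hp).2.2, mem_ball_zero_iff.2 (huntube hp).1⟩
  · rintro ⟨b, z⟩ ⟨hb, hz⟩
    have hz := mem_ball_zero_iff.1 hz
    simp only
    rw [h.invOn.2 (htube hb hz), untube_tube hz (hB hb).2, bookCoord_tube _ (hB hb).2,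
      h.invOn.1 (hB hb).1]
  · intro p hp
    obtain ⟨h1, h2, h3⟩ := huntube hp
    simp only
    rw [h.invOn.2 h2, tube_untube h1, h.invOn.1 hp.1]
  · intro b hb
    have : tube 0 (Ψ b) = Ψ b := by simp [tube, shear, axisPair]
    simp only
    rw [this, h.invOn.1 (hB hb).1]
  · intro b hb z hz _
    have h1 := htube hb (mem_ball_zero_iff.1 hz)
    simp only
    rw [h.bookMap_inv h1, bookMap_eq, bookCoord_tube _ (hB hb).2]

end IsBookDiffeo

end Transfer

/-! ### The modified Gauss map -/

section GaussMap

open Filter Topology Set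

variable {n : ℕ} {f : Euc n → ℝ}

/-- The unit normal `ν = ∇f / ‖∇f‖`. -/
noncomputable def unitNormal (f : Euc n → ℝ) (x : Euc n) : Euc n :=
  ‖gradient f x‖⁻¹ • gradient f x

/-- The vector `(x₀, ν₁, …, νₙ)`: the unit normal with its coordinate of index `0` replaced by
`x₀`. -/
noncomputable def mixedNormal (f : Euc n → ℝ) (x : Euc n) : Euc n :=
  unitNormal f x + (x 0 - unitNormal f x 0) • axis n

/-- The modified Gauss map, `mixedNormal` normalized to unit length. -/
noncomputable def bookGauss (f : Euc n → ℝ) (x : Euc n) : Euc n :=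
  ‖mixedNormal f x‖⁻¹ • mixedNormal f x

/-- The extension `(1 + f) · bookGauss f` of the modified Gauss map to a neighborhood of the
hypersurface, whose norm is `1` exactly on the hypersurface. -/
noncomputable def bookGaussExt (f : Euc n → ℝ) (x : Euc n) : Euc n :=
  ((1 + f x) * ‖mixedNormal f x‖⁻¹) • mixedNormal f x

theorem mixedNormal_zero (x : Euc n) : mixedNormal f x 0 = x 0 := by simp [mixedNormal]

theorem bookGaussExt_eq {x : Euc n} (hx : f x = 0) : bookGaussExt f x = bookGauss f x := by
  simp [bookGaussExt, bookGauss, hx]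

theorem fderiv_eq_unitNormal {x : Euc n} (h : fderiv ℝ f x ≠ 0) (v : Euc n) :
    fderiv ℝ f x v = ‖gradient f x‖ * inner ℝ (unitNormal f x) v := by
  have := norm_ne_zero_iff.2 (gradient_ne_zero h)
  rw [unitNormal, real_inner_smul_left, gradient_inner]
  field_simp

theorem unitNormal_inner_self {x : Euc n} (h : gradient f x ≠ 0) :
    inner ℝ (unitNormal f x) (unitNormal f x) = (1 : ℝ) := by
  have := norm_ne_zero_iff.2 h
  rw [unitNormal, real_inner_smul_left, real_inner_smul_right, real_inner_self_eq_norm_sq]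
  field_simp

/-- The algebra behind the injectivity of the modified Gauss map. Here `D`, `a`, `b` stand for
`‖mixedNormal‖`, `x₀`, `ν₀` at one point, the primed letters for the same quantities at another point,
and `P`, `P'` for the products of the two normals with the difference of the points. -/
theorem false_of_support_inequalities {D D' a a' b b' P P' : ℝ} (hD : 0 < D) (hD' : 0 < D')
    (hD2 : D ^ 2 = a ^ 2 + 1 - b ^ 2) (hD2' : D' ^ 2 = a' ^ 2 + 1 - b' ^ 2)
    (e0 : D * a' = D' * a)
    (eP : D * (P' + (a' - b') * (a' - a)) = D' * (P + (a - b) * (a' - a)))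
    (hP : P < 0) (hP' : 0 < P') (hp : a ≠ 0 → 0 < a * b) (hp' : a' ≠ 0 → 0 < a' * b') :
    False := by
  have h1 : 0 < (D * b' - D' * b) * (a' - a) := by
    have h2 := mul_pos hD hP'
    have h3 := mul_pos_of_neg_of_neg hP (neg_lt_zero.2 hD')
    have h4 : (D * b' - D' * b) * (a' - a) = D * P' - D' * P := by
      linear_combination -eP + (a' - a) * e0
    rw [h4]
    linarith
  have h2 : 0 < (D * (a * b') - D' * (a * b)) * (D' - D) := by
    have h3 : (D * (a * b') - D' * (a * b)) * (D' - D) =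
        D * ((D * b' - D' * b) * (a' - a)) := by
      linear_combination (-(D * b' - D' * b)) * e0
    rw [h3]
    exact mul_pos hD h1
  have ha : a ≠ 0 := by
    rintro rfl
    simp at h2
  have hDa' : 0 < D * (a * a') := by
    have h3 : D * (a * a') = D' * a ^ 2 := by linear_combination a * e0
    rw [h3]
    positivity
  have haa' : 0 < a * a' := (mul_pos_iff_of_pos_left hD).1 hDa'
  have ha' : a' ≠ 0 := fun hh => by simp [hh] at haa'
  have hab := hp ha
  have hab' : 0 < a * b' := by
    have h3 : 0 < a' ^ 2 * (a * b') := by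
      have h4 : a' ^ 2 * (a * b') = (a * a') * (a' * b') := by ring
      rw [h4]
      exact mul_pos haa' (hp' ha')
    exact (mul_pos_iff_of_pos_left (by positivity)).1 h3
  have hsq : D ^ 2 * (1 - b' ^ 2) = D' ^ 2 * (1 - b ^ 2) := by
    linear_combination D' ^ 2 * hD2 - D ^ 2 * hD2' - (D * a' + D' * a) * e0
  have hsq' : (D * (a * b')) ^ 2 - (D' * (a * b)) ^ 2 = a ^ 2 * (D ^ 2 - D' ^ 2) := by
    linear_combination (-a ^ 2) * hsq
  have ha2 : 0 < a ^ 2 := by positivity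
  rcases lt_trichotomy D D' with hlt | heq | hgt
  · have h3 := (mul_pos_iff_of_pos_right (sub_pos.2 hlt)).1 h2
    have h4 := pow_lt_pow_left₀ (sub_pos.1 h3) (mul_pos hD' hab).le two_ne_zero
    have h5 := pow_lt_pow_left₀ hlt hD.le two_ne_zero
    have := mul_pos ha2 (sub_pos.2 h5)
    linarith
  · simp [heq] at h2
  · have h3 := neg_of_mul_pos_left h2 (sub_neg.2 hgt).le
    have h4 := pow_lt_pow_left₀ (sub_neg.1 h3) (mul_pos hD hab').le two_ne_zero
    have h5 := pow_lt_pow_left₀ hgt hD'.le two_ne_zero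
    have := mul_pos ha2 (sub_pos.2 h5)
    linarith

namespace IsConvexSymmetric

variable (h : IsConvexSymmetric f)
include h

theorem gradient_ne_zero {x : Euc n} (hx : f x = 0) : gradient f x ≠ 0 :=
  _root_.gradient_ne_zero (h.regular x hx)

theorem norm_gradient_pos {x : Euc n} (hx : f x = 0) : 0 < ‖gradient f x‖ :=
  norm_pos_iff.2 (h.gradient_ne_zero hx)

theorem unitNormal_inner {x : Euc n} (hx : f x = 0) (v : Euc n) :
    inner ℝ (unitNormal f x) v = 0 ↔ fderiv ℝ f x v = 0 := by
  rw [fderiv_eq_unitNormal (h.regular x hx), mul_eq_zero_iff_left (h.norm_gradient_pos hx).ne']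

/-- `x₀ ν₀ > 0` off the equator. -/
theorem mul_unitNormal_pos {x : Euc n} (hx : f x = 0) (hx0 : x 0 ≠ 0) :
    0 < x 0 * unitNormal f x 0 := by
  have h1 := h.mul_fderiv_axis_pos hx hx0
  rw [fderiv_eq_unitNormal (h.regular x hx), inner_axis] at h1
  have h2 := h.norm_gradient_pos hx
  have h3 : 0 < ‖gradient f x‖ * (x 0 * unitNormal f x 0) := by linarith
  exact (mul_pos_iff_of_pos_left h2).1 h3

theorem unitNormal_zero {x : Euc n} (hx : f x = 0) (hx0 : x 0 = 0) : unitNormal f x 0 = 0 := by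
  simp [unitNormal, gradient_zero_coord, h.fderiv_axis_of_equator hx hx0]

theorem mul_unitNormal_nonneg {x : Euc n} (hx : f x = 0) : 0 ≤ x 0 * unitNormal f x 0 := by
  by_cases hx0 : x 0 = 0
  · simp [hx0]
  · exact (h.mul_unitNormal_pos hx hx0).le

theorem mixedNormal_ne_zero {x : Euc n} (hx : f x = 0) : mixedNormal f x ≠ 0 := by
  intro hV
  have hx0 : x 0 = 0 := by rw [← mixedNormal_zero (f := f) x, hV]; rfl
  have h1 := unitNormal_inner_self (h.gradient_ne_zero hx)
  rw [mixedNormal, h.unitNormal_zero hx hx0, hx0, sub_zero, zero_smul, add_zero] at hV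
  rw [hV, inner_zero_left] at h1
  exact zero_ne_one h1

theorem norm_mixedNormal_pos {x : Euc n} (hx : f x = 0) : 0 < ‖mixedNormal f x‖ :=
  norm_pos_iff.2 (h.mixedNormal_ne_zero hx)

theorem norm_mixedNormal_sq {x : Euc n} (hx : f x = 0) :
    ‖mixedNormal f x‖ ^ 2 = x 0 ^ 2 + 1 - unitNormal f x 0 ^ 2 := by
  rw [← real_inner_self_eq_norm_sq, mixedNormal]
  simp only [inner_add_left, inner_add_right, real_inner_smul_left, real_inner_smul_right,
    unitNormal_inner_self (h.gradient_ne_zero hx), inner_axis, axis_inner, axis_zero]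
  ring

theorem contDiffAt_unitNormal {x : Euc n} (hx : f x = 0) : ContDiffAt ℝ ∞ (unitNormal f) x := by
  have hg := (contDiff_gradient h.smooth).contDiffAt (x := x)
  exact ((hg.norm ℝ (h.gradient_ne_zero hx)).inv (h.norm_gradient_pos hx).ne').smul hg

theorem contDiffAt_mixedNormal {x : Euc n} (hx : f x = 0) :
    ContDiffAt ℝ ∞ (mixedNormal f) x := by
  have h1 := h.contDiffAt_unitNormal hx
  have h2 : ContDiff ℝ ∞ fun y : Euc n => y 0 :=
    (EuclideanSpace.proj (𝕜 := ℝ) (0 : Fin (n + 1))).contDiff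
  exact h1.add ((h2.contDiffAt.sub (h2.contDiffAt.comp x h1)).smul contDiffAt_const)

theorem contDiffAt_bookGauss {x : Euc n} (hx : f x = 0) : ContDiffAt ℝ ∞ (bookGauss f) x := by
  have hV := h.contDiffAt_mixedNormal hx
  exact ((hV.norm ℝ (h.mixedNormal_ne_zero hx)).inv (h.norm_mixedNormal_pos hx).ne').smul hV

theorem contDiffAt_bookGaussExt {x : Euc n} (hx : f x = 0) :
    ContDiffAt ℝ ∞ (bookGaussExt f) x := by
  have hV := h.contDiffAt_mixedNormal hx
  exact ((contDiffAt_const.add h.smooth.contDiffAt).mul ((hV.norm ℝ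
    (h.mixedNormal_ne_zero hx)).inv (h.norm_mixedNormal_pos hx).ne')).smul hV

theorem bookGauss_inner_self {x : Euc n} (hx : f x = 0) :
    inner ℝ (bookGauss f x) (bookGauss f x) = (1 : ℝ) := by
  have := (h.norm_mixedNormal_pos hx).ne'
  rw [bookGauss, real_inner_smul_left, real_inner_smul_right, real_inner_self_eq_norm_sq]
  field_simp

theorem eventually_bookGaussExt_inner_self {x : Euc n} (hx : f x = 0) :
    ∀ᶠ y in 𝓝 x, inner ℝ (bookGaussExt f y) (bookGaussExt f y) = (1 + f y) ^ 2 := by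
  filter_upwards [(h.contDiffAt_mixedNormal hx).continuousAt.eventually_ne
    (h.mixedNormal_ne_zero hx)] with y hy
  have := norm_ne_zero_iff.2 hy
  rw [bookGaussExt, real_inner_smul_left, real_inner_smul_right, real_inner_self_eq_norm_sq]
  field_simp

/-- The second fundamental form is the normalized Hessian. -/
theorem fderiv_unitNormal_inner {x v : Euc n} (hx : f x = 0) (hv : fderiv ℝ f x v = 0) :
    inner ℝ (fderiv ℝ (unitNormal f) x v) v =
      ‖gradient f x‖⁻¹ * fderiv ℝ (fderiv ℝ f) x v v := by
  have hν := (h.contDiffAt_unitNormal hx).differentiableAt (by simp)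
  have h1 : fderiv ℝ (fun y => inner ℝ (unitNormal f y) v) x v =
      inner ℝ (fderiv ℝ (unitNormal f) x v) v := by
    have := fderiv_inner_apply ℝ hν (differentiableAt_const v) v
    simpa using this
  have h2 : (fun y => inner ℝ (unitNormal f y) v) =
      fun y => ‖gradient f y‖⁻¹ * fderiv ℝ f y v := by
    funext y
    rw [unitNormal, real_inner_smul_left, gradient_inner]
  have hg := (contDiff_gradient h.smooth).contDiffAt (x := x)
  have h3 : DifferentiableAt ℝ (fun y => ‖gradient f y‖⁻¹) x :=
    ((hg.norm ℝ (h.gradient_ne_zero hx)).inv (h.norm_gradient_pos hx).ne').differentiableAt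
      (by simp)
  have h4 : HasFDerivAt (fun y => fderiv ℝ f y v) ((fderiv ℝ (fderiv ℝ f) x).flip v) x := by
    have := (((contDiff_fderiv h.smooth).differentiable (by simp)) x).hasFDerivAt.clm_apply
      (hasFDerivAt_const v x)
    refine this.congr_fderiv ?_
    ext w
    simp
  rw [← h1, h2, (h3.hasFDerivAt.fun_mul h4).fderiv]
  simp [hv]

theorem unitNormal_inner_fderiv {x : Euc n} (hx : f x = 0) (v : Euc n) :
    inner ℝ (unitNormal f x) (fderiv ℝ (unitNormal f) x v) = (0 : ℝ) := by
  have hν := (h.contDiffAt_unitNormal hx).differentiableAt (by simp)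
  have h1 : (fun y => inner ℝ (unitNormal f y) (unitNormal f y)) =ᶠ[𝓝 x] fun _ => (1 : ℝ) := by
    filter_upwards [(contDiff_gradient h.smooth).continuous.continuousAt.eventually_ne
      (h.gradient_ne_zero hx)] with y hy using unitNormal_inner_self hy
  have h2 := fderiv_inner_apply ℝ hν hν v
  rw [h1.fderiv_eq, real_inner_comm] at h2
  simp only [fderiv_fun_const, Pi.zero_apply, zero_apply] at h2
  rw [real_inner_comm] at h2
  linarith [real_inner_comm (unitNormal f x) (fderiv ℝ (unitNormal f) x v)]

/-- The extended modified Gauss map is a local diffeomorphism at the points of the hypersurface. A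
kernel vector `v` is tangent to the hypersurface, and the derivative of `mixedNormal` along it is a
multiple `κ` of `mixedNormal`. This forces `ν₀² ⟨dν(v), v⟩ = -κ² x₀ ν₀ ≤ 0`, while
`⟨dν(v), v⟩ > 0` for `v ≠ 0` by convexity. -/
theorem fderiv_bookGaussExt_injective {x : Euc n} (hx : f x = 0) :
    Function.Injective (fderiv ℝ (bookGaussExt f) x) := by
  rw [injective_iff_map_eq_zero]
  intro v hv
  have hG := (h.contDiffAt_bookGaussExt hx).differentiableAt (by simp)
  have hdf : fderiv ℝ f x v = 0 := by
    have h1 : (fun y => inner ℝ (bookGaussExt f y) (bookGaussExt f y)) =ᶠ[𝓝 x]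
      fun y => (1 + f y) ^ 2 := h.eventually_bookGaussExt_inner_self hx
    have h2 := fderiv_inner_apply ℝ hG hG v
    have h3 := (((h.smooth.differentiable (by simp)) x).hasFDerivAt.const_add 1).pow 2
    rw [h1.fderiv_eq, hv, inner_zero_left, inner_zero_right, h3.fderiv] at h2
    simpa [hx] using h2
  have hV := (h.contDiffAt_mixedNormal hx).differentiableAt (by simp)
  have hν := (h.contDiffAt_unitNormal hx).differentiableAt (by simp)
  have hD := h.norm_mixedNormal_pos hx
  have hρ : DifferentiableAt ℝ (fun y => (1 + f y) * ‖mixedNormal f y‖⁻¹) x :=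
    ((contDiffAt_const.add h.smooth.contDiffAt).mul (((h.contDiffAt_mixedNormal hx).norm ℝ
      (h.mixedNormal_ne_zero hx)).inv hD.ne')).differentiableAt (by simp)
  set w := fderiv ℝ (unitNormal f) x v with hw
  have hdV : fderiv ℝ (mixedNormal f) x v = w + (v 0 - w 0) • axis n := by
    let π₀ : Euc n →L[ℝ] ℝ := EuclideanSpace.proj 0
    have h1 : HasFDerivAt (fun y => unitNormal f y + (π₀ y - π₀ (unitNormal f y)) • axis n)
        _ x := hν.hasFDerivAt.add
      ((π₀.hasFDerivAt.sub (π₀.hasFDerivAt.comp x hν.hasFDerivAt)).smul_const (axis n))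
    have h2 : HasFDerivAt (mixedNormal f) _ x := h1
    rw [h2.fderiv]
    simp [π₀, hw]
  obtain ⟨κ, hκ⟩ : ∃ κ : ℝ, w + (v 0 - w 0) • axis n = κ • mixedNormal f x := by
    have h1 : HasFDerivAt (bookGaussExt f) _ x := hρ.hasFDerivAt.smul hV.hasFDerivAt
    rw [h1.fderiv] at hv
    simp only [hx, add_zero, one_mul, add_apply,
      smul_apply, ContinuousLinearMap.smulRight_apply, hdV] at hv
    set μ := fderiv ℝ (fun y => (1 + f y) * ‖mixedNormal f y‖⁻¹) x v
    refine ⟨-(‖mixedNormal f x‖ * μ), ?_⟩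
    have h2 := congrArg (‖mixedNormal f x‖ • ·) hv
    rw [smul_add, smul_zero, smul_inv_smul₀ hD.ne', smul_smul] at h2
    rw [neg_smul, eq_neg_iff_add_eq_zero, h2]
  set a := x 0 with ha
  set b := unitNormal f x 0 with hb
  have hνν := unitNormal_inner_self (h.gradient_ne_zero hx)
  have hνw : inner ℝ (unitNormal f x) w = (0 : ℝ) := h.unitNormal_inner_fderiv hx v
  have hνv : inner ℝ (unitNormal f x) v = (0 : ℝ) := (h.unitNormal_inner hx v).2 hdf
  have e0 : v 0 = κ * a := by
    have := congrArg (fun z : Euc n => z 0) hκ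
    simpa [mixedNormal_zero] using this
  have eν : (v 0 - w 0) * b = κ * (1 + (a - b) * b) := by
    have := congrArg (fun z : Euc n => inner ℝ (unitNormal f x) z) hκ
    simp only [mixedNormal, inner_add_right, real_inner_smul_right, inner_axis, hνν, hνw,
      zero_add] at this
    exact this
  have ev : inner ℝ w v + (v 0 - w 0) * v 0 = κ * ((a - b) * v 0) := by
    have := congrArg (fun z : Euc n => inner ℝ z v) hκ
    simpa [mixedNormal, inner_add_left, real_inner_smul_left, axis_inner, hνv] using this
  by_contra hv0
  have hq : 0 < inner ℝ w v := by
    rw [hw, h.fderiv_unitNormal_inner hx hdf]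
    exact mul_pos (inv_pos.2 (h.norm_gradient_pos hx)) (h.hessian_pos x v hx hdf hv0)
  by_cases ha0 : a = 0
  · rw [e0, ha0] at ev
    simp at ev
    linarith
  · have hab := h.mul_unitNormal_pos hx ha0
    have hb0 : b ≠ 0 := fun hh => by rw [← hb, hh] at hab; simp at hab
    have key : b ^ 2 * inner ℝ w v = -(κ ^ 2 * (a * b)) := by
      linear_combination b ^ 2 * ev - b * v 0 * eν - κ * b * e0
    have h1 : 0 < b ^ 2 * inner ℝ w v := mul_pos (by positivity) hq
    have h2 : 0 ≤ κ ^ 2 * (a * b) := mul_nonneg (sq_nonneg _) hab.le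
    linarith

theorem exists_hasFDerivAt_bookGaussExt {x : Euc n} (hx : f x = 0) :
    ∃ e : Euc n ≃L[ℝ] Euc n, HasFDerivAt (bookGaussExt f) (e : Euc n →L[ℝ] Euc n) x := by
  let e := (LinearEquiv.ofInjectiveEndo (fderiv ℝ (bookGaussExt f) x).toLinearMap
    (h.fderiv_bookGaussExt_injective hx)).toContinuousLinearEquiv
  refine ⟨e, ?_⟩
  have h1 := ((h.contDiffAt_bookGaussExt hx).differentiableAt (by simp)).hasFDerivAt
  refine h1.congr_fderiv ?_
  ext v
  simp [e]

/-- Near a point of the hypersurface, the extension takes values on the unit sphere only on the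
hypersurface. -/
theorem eventually_eq_zero_of_bookGaussExt {x : Euc n} (hx : f x = 0) :
    ∀ᶠ y in 𝓝 x, ‖bookGaussExt f y‖ = 1 → f y = 0 := by
  have h1 : ∀ᶠ y in 𝓝 x, -1 < f y :=
    h.smooth.continuous.continuousAt.eventually (lt_mem_nhds (by rw [hx]; norm_num))
  filter_upwards [h1, h.eventually_bookGaussExt_inner_self hx] with y hy1 hy2 hy3
  rw [real_inner_self_eq_norm_sq, hy3] at hy2
  have h4 : f y * (f y + 2) = 0 := by linarith
  exact (mul_eq_zero.1 h4).resolve_right (by linarith)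

theorem norm_bookGauss {x : Euc n} (hx : f x = 0) : ‖bookGauss f x‖ = 1 := by
  have := h.bookGauss_inner_self hx
  rw [real_inner_self_eq_norm_sq] at this
  exact (pow_eq_one_iff_of_nonneg (norm_nonneg _) two_ne_zero).1 this

/-- If the modified Gauss map takes the same value at two points, the support inequalities at the
two points contradict each other. -/
theorem injOn_bookGauss : InjOn (bookGauss f) {x | f x = 0} := by
  intro x hx x' hx' hG
  have hx : f x = 0 := hx
  have hx' : f x' = 0 := hx'
  by_contra hne
  have hD := h.norm_mixedNormal_pos hx
  have hD' := h.norm_mixedNormal_pos hx'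
  have hD2 := h.norm_mixedNormal_sq hx
  have hD2' := h.norm_mixedNormal_sq hx'
  have hs := h.support hx hx'.le (Ne.symm hne)
  have hs' := h.support hx' hx.le hne
  rw [fderiv_eq_unitNormal (h.regular x hx)] at hs
  rw [fderiv_eq_unitNormal (h.regular x' hx')] at hs'
  have hs := neg_of_mul_neg_right hs (h.norm_gradient_pos hx).le
  have hs' := neg_of_mul_neg_right hs' (h.norm_gradient_pos hx').le
  have hV : ‖mixedNormal f x‖ • mixedNormal f x' = ‖mixedNormal f x'‖ • mixedNormal f x := by
    have e1 : ∀ z, f z = 0 → mixedNormal f z = ‖mixedNormal f z‖ • bookGauss f z := fun z hz =>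
      (smul_inv_smul₀ (h.norm_mixedNormal_pos hz).ne' _).symm
    calc ‖mixedNormal f x‖ • mixedNormal f x'
        = ‖mixedNormal f x‖ • ‖mixedNormal f x'‖ • bookGauss f x' := congrArg _ (e1 x' hx')
      _ = ‖mixedNormal f x'‖ • ‖mixedNormal f x‖ • bookGauss f x := by rw [hG, smul_comm]
      _ = ‖mixedNormal f x'‖ • mixedNormal f x := congrArg _ (e1 x hx).symm
  have e0 : ‖mixedNormal f x‖ * x' 0 = ‖mixedNormal f x'‖ * x 0 := by
    have := congrArg (fun z : Euc n => z 0) hV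
    simpa [mixedNormal_zero] using this
  have eΔ : ‖mixedNormal f x‖ * (inner ℝ (unitNormal f x') (x' - x) +
        (x' 0 - unitNormal f x' 0) * (x' 0 - x 0)) =
      ‖mixedNormal f x'‖ * (inner ℝ (unitNormal f x) (x' - x) +
        (x 0 - unitNormal f x 0) * (x' 0 - x 0)) := by
    have := congrArg (fun z : Euc n => inner ℝ z (x' - x)) hV
    simpa only [mixedNormal, inner_add_left, real_inner_smul_left, axis_inner,
      PiLp.sub_apply] using this
  rw [← neg_sub x' x, inner_neg_right] at hs'
  have hp := h.mul_unitNormal_pos hx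
  have hp' := h.mul_unitNormal_pos hx'
  exact false_of_support_inequalities hD hD' hD2 hD2' e0 eΔ hs (by linarith) hp hp'

end IsConvexSymmetric

end GaussMap

/-! ### The diffeomorphism with the unit cotangent bundle of the sphere -/

section GaussDiffeo

open Filter Topology Set

variable {n : ℕ} {f : Euc n → ℝ}

/-- The inverse of the modified Gauss map. -/
noncomputable def bookGaussInv (f : Euc n → ℝ) : Euc n → Euc n :=
  Function.invFunOn (bookGauss f) {x | f x = 0}

/-- The rotation in the plane of the unit vectors `a`, `b` taking `a` to `b`, on vectors `y`
orthogonal to `a`. -/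
noncomputable def transport (a b y : Euc n) : Euc n :=
  y - (inner ℝ y b / (1 + inner ℝ a b)) • (a + b)

theorem transport_inner {a b : Euc n} (hb : inner ℝ b b = (1 : ℝ)) (hab : 1 + inner ℝ a b ≠ 0)
    (y : Euc n) : inner ℝ (transport a b y) b = (0 : ℝ) := by
  simp only [transport, inner_sub_left, real_inner_smul_left, inner_add_left, hb]
  field_simp
  ring

theorem transport_inner_self {a b y : Euc n} (ha : inner ℝ a a = (1 : ℝ))
    (hb : inner ℝ b b = (1 : ℝ)) (hab : 1 + inner ℝ a b ≠ 0) (hy : inner ℝ y a = (0 : ℝ)) :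
    inner ℝ (transport a b y) (transport a b y) = inner ℝ y y := by
  have hy' : inner ℝ a y = (0 : ℝ) := by rw [real_inner_comm, hy]
  simp only [transport, inner_sub_left, inner_sub_right, real_inner_smul_left,
    real_inner_smul_right, inner_add_left, inner_add_right, ha, hb, hy, hy',
    real_inner_comm y b, real_inner_comm a b]
  field_simp
  ring

theorem transport_transport {a b y : Euc n} (ha : inner ℝ a a = (1 : ℝ))
    (hab : 1 + inner ℝ a b ≠ 0) (hy : inner ℝ y a = (0 : ℝ)) :
    transport b a (transport a b y) = y := by
  have h1 : inner ℝ (transport a b y) a = -inner ℝ y b := by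
    simp only [transport, inner_sub_left, real_inner_smul_left, inner_add_left, ha, hy,
      real_inner_comm a b]
    field_simp
    ring
  rw [transport, h1, real_inner_comm a b, transport]
  module

theorem contDiffOn_transport {E : Type*} [NormedAddCommGroup E] [NormedSpace ℝ E] {S : Set E}
    {a b y : E → Euc n} (ha : ContDiffOn ℝ ∞ a S) (hb : ContDiffOn ℝ ∞ b S)
    (hy : ContDiffOn ℝ ∞ y S) (hab : ∀ x ∈ S, 1 + inner ℝ (a x) (b x) ≠ 0) :
    ContDiffOn ℝ ∞ (fun x => transport (a x) (b x) (y x)) S :=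
  hy.sub (((hy.inner ℝ hb).div (contDiffOn_const.add (ha.inner ℝ hb)) hab).smul (ha.add hb))

namespace IsConvexSymmetric

variable (h : IsConvexSymmetric f)
include h

theorem isClosed_image_bookGauss : IsClosed (bookGauss f '' {x | f x = 0}) :=
  (h.compact.image_of_continuousOn fun _ hx =>
    (h.contDiffAt_bookGauss hx).continuousAt.continuousWithinAt).isClosed

theorem surjOn_bookGauss : Metric.sphere (0 : Euc n) 1 ⊆ bookGauss f '' {x | f x = 0} := by
  have hrank : 1 < Module.rank ℝ (Euc n) := by
    rw [← Module.finrank_eq_rank, finrank_euclideanSpace, Fintype.card_fin]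
    have := h.pos
    exact_mod_cast (by omega : 1 < n + 1)
  have hS := (isConnected_sphere hrank (0 : Euc n) zero_le_one).isPreconnected
  set A := bookGauss f '' {x | f x = 0}
  have hA : IsClosed A := h.isClosed_image_bookGauss
  -- the image is open in the sphere, by the inverse function theorem
  have hint : A ⊆ interior (A ∪ (Metric.sphere (0 : Euc n) 1)ᶜ) := by
    rintro _ ⟨x, hx, rfl⟩
    have hx : f x = 0 := hx
    obtain ⟨e, he⟩ := h.exists_hasFDerivAt_bookGaussExt hx
    have hmap := ((h.contDiffAt_bookGaussExt hx).hasStrictFDerivAt' he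
      (by simp)).map_nhds_eq_of_equiv
    rw [mem_interior_iff_mem_nhds, ← bookGaussExt_eq hx, ← hmap, mem_map]
    filter_upwards [h.eventually_eq_zero_of_bookGaussExt hx] with y hy
    by_cases hy1 : ‖bookGaussExt f y‖ = 1
    · exact Or.inl ⟨y, hy hy1, (bookGaussExt_eq (hy hy1)).symm⟩
    · exact Or.inr fun hh => hy1 (mem_sphere_zero_iff_norm.1 hh)
  have hAS : A ⊆ Metric.sphere (0 : Euc n) 1 := by
    rintro _ ⟨x, hx, rfl⟩
    exact mem_sphere_zero_iff_norm.2 (h.norm_bookGauss hx)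
  rcases isPreconnected_iff_subset_of_disjoint.1 hS _ _ isOpen_interior hA.isOpen_compl
    (fun u _ => (em (u ∈ A)).imp (fun hu => hint hu) id) (by
      rw [Set.eq_empty_iff_forall_notMem]
      rintro u ⟨hu, hu1, hu2⟩
      exact (interior_subset hu1).elim hu2 fun hh => hh hu) with hsub | hsub
  · exact fun u hu => (interior_subset (hsub hu)).resolve_right fun hh => hh hu
  · obtain ⟨x, hx⟩ := h.connected.nonempty
    exact absurd (mem_image_of_mem _ hx) (hsub (hAS (mem_image_of_mem _ hx)))

theorem bookGaussInv_spec {u : Euc n} (hu : ‖u‖ = 1) :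
    f (bookGaussInv f u) = 0 ∧ bookGauss f (bookGaussInv f u) = u := by
  have hex := h.surjOn_bookGauss (mem_sphere_zero_iff_norm.2 hu)
  exact ⟨Function.invFunOn_mem hex, Function.invFunOn_eq hex⟩

theorem bookGaussInv_bookGauss {x : Euc n} (hx : f x = 0) :
    bookGaussInv f (bookGauss f x) = x := by
  obtain ⟨h1, h2⟩ := h.bookGaussInv_spec (h.norm_bookGauss hx)
  exact h.injOn_bookGauss h1 hx h2

theorem contDiffOn_bookGaussInv :
    ContDiffOn ℝ ∞ (bookGaussInv f) (Metric.sphere (0 : Euc n) 1) := by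
  intro u hu
  obtain ⟨hx, hxu⟩ := h.bookGaussInv_spec (mem_sphere_zero_iff_norm.1 hu)
  set x := bookGaussInv f u with hxdef
  obtain ⟨e, he⟩ := h.exists_hasFDerivAt_bookGaussExt hx
  have hC := h.contDiffAt_bookGaussExt hx
  have h0 : (∞ : WithTop ℕ∞) ≠ 0 := by simp
  have hxu' : bookGaussExt f x = u := by rw [bookGaussExt_eq hx, hxu]
  have hφ := hC.to_localInverse he h0
  have hφx := hC.localInverse_apply_image he h0
  have hright := (hC.hasStrictFDerivAt' he h0).eventually_right_inverse
  rw [hxu'] at hφ hφx hright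
  set φ := hC.localInverse he h0
  have htend : Tendsto φ (𝓝 u) (𝓝 x) := by
    have := hφ.continuousAt.tendsto
    rwa [hφx] at this
  refine hφ.contDiffWithinAt.congr_of_eventuallyEq ?_ ?_
  · have hev := (htend.eventually (h.eventually_eq_zero_of_bookGaussExt hx)).and hright
    filter_upwards [hev.filter_mono nhdsWithin_le_nhds, self_mem_nhdsWithin] with u' hu' hu'S
    have hu'1 : bookGaussExt f (φ u') = u' := hu'.2
    have hf0 : f (φ u') = 0 := hu'.1 (by rw [hu'1]; exact mem_sphere_zero_iff_norm.1 hu'S)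
    rw [bookGaussExt_eq hf0] at hu'1
    rw [← hu'1, h.bookGaussInv_bookGauss hf0, hu'1]
  · rw [hφx]

theorem unitNormal_inner_bookGauss {x : Euc n} (hx : f x = 0) :
    inner ℝ (unitNormal f x) (bookGauss f x) =
      ‖mixedNormal f x‖⁻¹ * (1 - unitNormal f x 0 ^ 2 + x 0 * unitNormal f x 0) := by
  simp only [bookGauss, real_inner_smul_right, mixedNormal, inner_add_right, inner_axis,
    unitNormal_inner_self (h.gradient_ne_zero hx)]
  ring

theorem sq_unitNormal_zero_le {x : Euc n} (hx : f x = 0) : unitNormal f x 0 ^ 2 ≤ 1 := by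
  have h1 := unitNormal_inner_self (h.gradient_ne_zero hx)
  rw [real_inner_self_eq_norm_sq] at h1
  have h2 := abs_coord_zero_le (unitNormal f x)
  rw [← h1, ← sq_abs]
  exact pow_le_pow_left₀ (abs_nonneg _) h2 2

/-- The unit normal and the modified Gauss map are never antipodal. -/
theorem one_add_inner_pos {x : Euc n} (hx : f x = 0) :
    0 < 1 + inner ℝ (unitNormal f x) (bookGauss f x) := by
  rw [h.unitNormal_inner_bookGauss hx]
  have h1 := h.sq_unitNormal_zero_le hx
  have h2 := h.mul_unitNormal_nonneg hx
  have h3 := inv_pos.2 (h.norm_mixedNormal_pos hx)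
  have := mul_nonneg h3.le (by linarith :
    0 ≤ 1 - unitNormal f x 0 ^ 2 + x 0 * unitNormal f x 0)
  linarith

/-- Transport from the unit normal to the modified Gauss map scales `y₀` by the same factor by which
`x₀` is scaled. -/
theorem transport_zero {x y : Euc n} (hx : f x = 0) (hy : fderiv ℝ f x y = 0) :
    transport (unitNormal f x) (bookGauss f x) y 0 = ‖mixedNormal f x‖⁻¹ * y 0 := by
  have hD := h.norm_mixedNormal_pos hx
  have hD2 := h.norm_mixedNormal_sq hx
  have hpos := h.one_add_inner_pos hx
  have hyν : inner ℝ y (unitNormal f x) = (0 : ℝ) := by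
    rw [real_inner_comm]; exact (h.unitNormal_inner hx y).2 hy
  have h1 : inner ℝ y (bookGauss f x) =
      ‖mixedNormal f x‖⁻¹ * ((x 0 - unitNormal f x 0) * y 0) := by
    simp only [bookGauss, real_inner_smul_right, mixedNormal, inner_add_right, inner_axis, hyν,
      zero_add]
  have h2 : bookGauss f x 0 = ‖mixedNormal f x‖⁻¹ * x 0 := by
    simp [bookGauss, mixedNormal_zero]
  simp only [transport, PiLp.sub_apply, PiLp.smul_apply, PiLp.add_apply, smul_eq_mul, h2]
  rw [h1]
  rw [h.unitNormal_inner_bookGauss hx] at hpos ⊢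
  generalize ‖mixedNormal f x‖ = D at *
  generalize unitNormal f x 0 = b at *
  have h3 : 0 < D + (1 - b ^ 2 + x 0 * b) := by
    have := mul_pos hD hpos
    rw [mul_add, ← mul_assoc, mul_inv_cancel₀ hD.ne'] at this
    linarith
  have h4 : 1 + D⁻¹ * (1 - b ^ 2 + x 0 * b) = D⁻¹ * (D + (1 - b ^ 2 + x 0 * b)) := by
    field_simp
  rw [h4]
  field_simp
  linear_combination y 0 * hD2

/-- The diffeomorphism of the unit cotangent bundle of the hypersurface with that of the sphere. -/
theorem isBookDiffeo :
    IsBookDiffeo (unitCotangentBundle (levelHypersurface f)) (unitCotangentBundle (equator f))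
      (fun p => (bookGauss f p.1, transport (unitNormal f p.1) (bookGauss f p.1) p.2))
      (fun q => (bookGaussInv f q.1,
        transport q.1 (unitNormal f (bookGaussInv f q.1)) q.2)) := by
  have hYν : ∀ p ∈ unitCotangentBundle (levelHypersurface f),
      inner ℝ p.2 (unitNormal f p.1) = (0 : ℝ) := by
    intro p hp
    obtain ⟨h1, h2, h3⟩ := h.mem_unitCotangentBundle.1 hp
    rw [real_inner_comm]
    exact (h.unitNormal_inner h1 _).2 h2
  have hnorm : ∀ {v : Euc n}, inner ℝ v v = (1 : ℝ) ↔ ‖v‖ = 1 := by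
    intro v
    rw [real_inner_self_eq_norm_sq, pow_eq_one_iff_of_nonneg (norm_nonneg _) two_ne_zero]
  have hS : ∀ {q : Euc n × Euc n}, q ∈ sphereBundle n →
      f (bookGaussInv f q.1) = 0 ∧ bookGauss f (bookGaussInv f q.1) = q.1 ∧
      inner ℝ (unitNormal f (bookGaussInv f q.1)) (unitNormal f (bookGaussInv f q.1)) = (1 : ℝ) ∧
      1 + inner ℝ q.1 (unitNormal f (bookGaussInv f q.1)) ≠ 0 ∧
      inner ℝ q.2 q.1 = (0 : ℝ) := by
    intro q hq
    obtain ⟨h1, h2⟩ := h.bookGaussInv_spec (hnorm.1 hq.1)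
    have h3 := h.one_add_inner_pos h1
    rw [h2, real_inner_comm] at h3
    exact ⟨h1, h2, unitNormal_inner_self (h.gradient_ne_zero h1), h3.ne', by
      rw [real_inner_comm]; exact hq.2.2⟩
  have hG : ContDiffOn ℝ ∞ (fun p : Euc n × Euc n => bookGauss f p.1)
      (unitCotangentBundle (levelHypersurface f)) := fun p hp =>
    ((h.contDiffAt_bookGauss (h.mem_unitCotangentBundle.1 hp).1).comp p
      contDiffAt_fst).contDiffWithinAt
  have hν : ContDiffOn ℝ ∞ (fun p : Euc n × Euc n => unitNormal f p.1)
      (unitCotangentBundle (levelHypersurface f)) := fun p hp =>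
    ((h.contDiffAt_unitNormal (h.mem_unitCotangentBundle.1 hp).1).comp p
      contDiffAt_fst).contDiffWithinAt
  have hI : ContDiffOn ℝ ∞ (fun q : Euc n × Euc n => bookGaussInv f q.1) (sphereBundle n) :=
    h.contDiffOn_bookGaussInv.comp contDiff_fst.contDiffOn fun q hq =>
      mem_sphere_zero_iff_norm.2 (hnorm.1 hq.1)
  have hνI : ContDiffOn ℝ ∞ (fun q : Euc n × Euc n => unitNormal f (bookGaussInv f q.1))
      (sphereBundle n) := fun q hq =>
    ContDiffAt.comp_contDiffWithinAt (g := unitNormal f) q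
      (h.contDiffAt_unitNormal (hS hq).1) (hI q hq)
  refine ⟨?_, ?_, ?_, ?_, ⟨?_, ?_⟩, ?_, ?_⟩
  · exact hG.prodMk (contDiffOn_transport hν hG contDiff_snd.contDiffOn fun p hp =>
      (h.one_add_inner_pos (h.mem_unitCotangentBundle.1 hp).1).ne')
  · exact hI.prodMk (contDiffOn_transport contDiff_fst.contDiffOn hνI contDiff_snd.contDiffOn
      fun q hq => (hS hq).2.2.2.1)
  · intro p hp
    obtain ⟨h1, h2, h3⟩ := h.mem_unitCotangentBundle.1 hp
    have hb := h.bookGauss_inner_self h1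
    have hab := (h.one_add_inner_pos h1).ne'
    refine ⟨hb, ?_, ?_⟩
    · simp only
      rw [transport_inner_self (unitNormal_inner_self (h.gradient_ne_zero h1)) hb hab (hYν p hp)]
      exact hnorm.2 h3
    · simp only
      rw [real_inner_comm]
      exact transport_inner hb hab _
  · intro q hq
    obtain ⟨h1, h2, h3, h4, h5⟩ := hS hq
    refine h.mem_unitCotangentBundle.2 ⟨h1, ?_, ?_⟩
    · rw [← h.unitNormal_inner h1, real_inner_comm]
      exact transport_inner h3 h4 _
    · apply hnorm.1
      simp only
      rw [transport_inner_self hq.1 h3 h4 h5]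
      exact hq.2.1
  · intro p hp
    obtain ⟨h1, h2, h3⟩ := h.mem_unitCotangentBundle.1 hp
    simp only
    rw [h.bookGaussInv_bookGauss h1, transport_transport
      (unitNormal_inner_self (h.gradient_ne_zero h1)) (h.one_add_inner_pos h1).ne' (hYν p hp)]
  · intro q hq
    obtain ⟨h1, h2, h3, h4, h5⟩ := hS hq
    simp only
    rw [h2, transport_transport hq.1 h4 h5]
  · intro p
    rw [h.mem_binding, bookCoord_eq_zero]
  · intro p hp
    obtain ⟨h1, h2, h3⟩ := h.mem_unitCotangentBundle.1 hp
    refine ⟨‖mixedNormal f p.1‖⁻¹, inv_pos.2 (h.norm_mixedNormal_pos h1), ?_⟩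
    apply Complex.ext
    · rw [Complex.re_ofReal_mul]
      simp [bookCoord, bookGauss, mixedNormal_zero]
    · rw [Complex.im_ofReal_mul]
      exact h.transport_zero h1 h2

/-- In the hypersurface, the tube `|x₀ + i y₀| < ‖mixedNormal‖` is given by
`y₀² ‖∇f‖² + (∂f/∂x₀)² < ‖∇f‖²`, an open condition on the ambient space. -/
theorem exists_open_tube : ∃ O : Set (Euc n × Euc n), IsOpen O ∧
    ∀ p ∈ unitCotangentBundle (levelHypersurface f), p ∈ O ↔
      ‖bookCoord ((bookGauss f p.1, transport (unitNormal f p.1) (bookGauss f p.1) p.2) :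
        Euc n × Euc n)‖ < 1 := by
  have hg : Continuous fun p : Euc n × Euc n => gradient f p.1 :=
    (contDiff_gradient h.smooth).continuous.comp continuous_fst
  refine ⟨{p | p.2 0 ^ 2 * ‖gradient f p.1‖ ^ 2 + gradient f p.1 0 ^ 2 < ‖gradient f p.1‖ ^ 2},
    isOpen_lt (by fun_prop) (by fun_prop), fun p hp => ?_⟩
  obtain ⟨h1, h2, h3⟩ := h.mem_unitCotangentBundle.1 hp
  have hD := h.norm_mixedNormal_pos h1
  have hD2 := h.norm_mixedNormal_sq h1
  have hgpos := h.norm_gradient_pos h1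
  have hb : gradient f p.1 0 = ‖gradient f p.1‖ * unitNormal f p.1 0 := by
    simp [unitNormal, hgpos.ne']
  have hc : ‖bookCoord ((bookGauss f p.1, transport (unitNormal f p.1) (bookGauss f p.1) p.2) :
      Euc n × Euc n)‖ ^ 2 = (‖mixedNormal f p.1‖⁻¹) ^ 2 * (p.1 0 ^ 2 + p.2 0 ^ 2) := by
    rw [← Complex.normSq_eq_norm_sq, Complex.normSq_apply]
    have e1 : (bookCoord ((bookGauss f p.1, transport (unitNormal f p.1) (bookGauss f p.1) p.2) :
        Euc n × Euc n)).re = ‖mixedNormal f p.1‖⁻¹ * p.1 0 := by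
      simp [bookCoord, bookGauss, mixedNormal_zero]
    have e2 : (bookCoord ((bookGauss f p.1, transport (unitNormal f p.1) (bookGauss f p.1) p.2) :
        Euc n × Euc n)).im = ‖mixedNormal f p.1‖⁻¹ * p.2 0 := h.transport_zero h1 h2
    rw [e1, e2]
    ring
  rw [← sq_lt_one_iff₀ (norm_nonneg _), hc, inv_pow, inv_mul_lt_iff₀ (by positivity), hD2,
    mem_ofPred_eq, hb]
  have hg2 : 0 < ‖gradient f p.1‖ ^ 2 := by positivity
  constructor
  · intro hlt
    have : ‖gradient f p.1‖ ^ 2 * (p.2 0 ^ 2 + unitNormal f p.1 0 ^ 2) <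
        ‖gradient f p.1‖ ^ 2 * 1 := by linarith
    have := lt_of_mul_lt_mul_left this hg2.le
    linarith
  · intro hlt
    have : ‖gradient f p.1‖ ^ 2 * (p.2 0 ^ 2 + unitNormal f p.1 0 ^ 2) <
        ‖gradient f p.1‖ ^ 2 * 1 := mul_lt_mul_of_pos_left (by linarith) hg2
    linarith

theorem isOpenBookDecomposition :
    IsOpenBookDecomposition (unitCotangentBundle (levelHypersurface f))
      (unitCotangentBundle (equator f)) bookMap := by
  obtain ⟨O, hO, hYO⟩ := h.exists_open_tube
  have hpage := h.page_eq_pageSet (w := 1) (a := 1) (b := 0) (by simp) (by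
    have : (⟨1, 0⟩ : ℂ) = 1 := rfl
    rw [this]; simp)
  exact ⟨h.isCompact_unitCotangentBundle, fun p hp => (h.mem_binding.1 hp).1, h.isClosed_binding,
    ⟨3, h.isEmbeddedSubmanifold_unitCotangentBundle, h.isEmbeddedSubmanifold_binding, _,
      hpage ▸ h.isEmbeddedSubmanifold_pageSet 1 0,
      h.isBookDiffeo.isFiberBundleOverCircle h.pos⟩,
    h.isBookDiffeo.exists_tubularNeighborhood hO hYO⟩

end IsConvexSymmetric

end GaussDiffeo

theorem mainTheorem2 {n : ℕ} (hn : 1 ≤ n) (f : Euc n → ℝ)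
    (hf : ContDiff ℝ ∞ f)
    (hreg : ∀ x ∈ levelHypersurface f, fderiv ℝ f x ≠ 0)
    (hcompact : IsCompact (levelHypersurface f))
    (hconn : IsConnected (levelHypersurface f))
    (hN : (equator f).Nonempty)
    (hA1 : IsSymmetricNearEquator f)
    (hA2 : HasPositiveHessian f) :
    IsOpenBookDecomposition (unitCotangentBundle (levelHypersurface f))
        (unitCotangentBundle (equator f)) bookMap ∧
      (∃ X, IsGeodesicVectorField (levelHypersurface f) X) ∧
      (∀ X, IsGeodesicVectorField (levelHypersurface f) X →
        IsAdaptedTo (unitCotangentBundle (levelHypersurface f))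
          (unitCotangentBundle (equator f)) bookMap X) ∧
      ∃ ε : ℝ, 0 < ε ∧ ∀ X, IsGeodesicVectorField (levelHypersurface f) X →
        ∀ p ∈ unitCotangentBundle (levelHypersurface f) \ unitCotangentBundle (equator f),
          ε < angularForm p (X p) := by
  have h : IsConvexSymmetric f := by
    refine ⟨hn, hf, hreg, hcompact, hconn, fun x y hx hy hy0 => ?_, hN, ?_⟩
    · exact hA2 (x, y) ((mem_cotangentBundle hf hreg).2 ⟨hx, hy⟩) hy0
    · obtain ⟨δ, hδ, hsymm⟩ := hA1
      exact ⟨δ, hδ, fun x hx hxδ => (hsymm x hx hxδ).symm.trans hx⟩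
  refine ⟨h.isOpenBookDecomposition, ⟨_, h.isGeodesicVectorField_geodesicField⟩,
    fun X hX => h.isAdaptedTo hX, ?_⟩
  obtain ⟨ε, hε, hle⟩ := h.exists_angular_lower_bound
  refine ⟨ε / 2, by positivity, fun X hX p hp => ?_⟩
  obtain ⟨hpY, hp0⟩ := h.mem_sdiff_binding.1 hp
  have hden : 0 < p.1 0 ^ 2 + p.2 0 ^ 2 := by
    rcases not_and_or.1 hp0 with h0 | h0
    · positivity
    · positivity
  rw [h.eq_geodesicField hX hpY.1, angularForm, lt_div_iff₀ hden]
  have h1 := hle p hpY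
  have h2 := mul_pos hε hden
  linarith
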